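/- Let $G$ be a (discrete) group with unit $e$ and let $\mathcal A=\bigoplus_{g\in G}\mathcal A_g$ be a $G$-graded unital complex $*$-algebra, i.e. a direct sum of vector spaces with $\mathcal A_g\mathcal A_h\subseteq\mathcal A_{gh}$ and $(\mathcal A_g)^*\subseteq\mathcal A_{g^{-1}}$, such that the unital $*$-subalgebra $\mathcal B:=\mathcal A_e$ is commutative. Let $p:\mathcal A\to\mathcal B$, $p(a)=a_e$, be the canonical projection. Let $\sum\mathcal A^2$ be the cone of finite sums of elements $a^*a$, $a\in\mathcal A$, and let $\widehat{\mathcal B}^+$ be the set of characters (nonzero $*$-homomorphisms $\mathcal B\to\mathbb C$) that are nonnegative on $\mathcal B\cap\sum\mathcal A^2$. Assume that $$\chi(c^*d)\,\chi(d^*c)=\chi(c^*c)\,\chi(d^*d)\qquad\text{for all }\chi\in\widehat{\mathcal B}^+,\ g\in G,\ c,d\in\mathcal A_g .$$ For $\chi\in\widehat{\mathcal B}^+$ and $g\in G$, $\chi^g$ is said to be defined if $\chi(a^*a)\neq0$ for some $a\in\mathcal A_g$; then $\chi^g\in\widehat{\mathcal B}^+$ is the character $\chi^g(b)=\chi(a^*ba)/\chi(a^*a)$,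 $b\in\mathcal B$, which does not depend on the choice of such $a$. The stabilizer group of $\chi$ is $\mathrm{St}\,\chi=\{g\in G:\chi^g\text{ is defined and equal to }\chi\}$. A $*$-representation of $\mathcal A$ on a dense linear subspace $\mathcal D(\pi)$ of a Hilbert space is an algebra homomorphism $\pi$ of $\mathcal A$ into the linear operators on $\mathcal D(\pi)$ with $\langle\pi(a)\varphi,\psi\rangle=\langle\varphi,\pi(a^*)\psi\rangle$. Its closure $\overline\pi$ has as domain the completion of $\mathcal D(\pi)$ in the graph topology (given by the norms $\varphi\mapsto\|\varphi\|+\|\pi(a)\varphi\|$, $a\in\mathcal A$), and $\overline\pi(a)$ is the restriction of the closure of the operator $\pi(a)$ to this domain. A $*$-representation $\pi$ is irreducible if a direct sum decomposition $\pi=\pi_1\oplus\pi_2$ into $*$-representations is possible only when $\mathcal D(\pi_1)=\{0\}$ or $\mathcal D(\pi_2)=\{0\}$. For $\chi\in\widehat{\mathcal B}^+$, the formula $\langle x\otimes s,y\otimes t\rangle_0=\chi(p(y^*x))\,s\,\overline t$ defines a nonnegative sesquilinear form on $\mathcal A\otimes\mathbb C$; let $\mathcal K$ be its kernel. The induced representation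 $\mathrm{Ind}\,\chi$ is the closure of the $*$-representation $\pi_0(a)[x\otimes t]=[ax\otimes t]$ of $\mathcal A$ on the pre-Hilbert space $(\mathcal A\otimes\mathbb C)/\mathcal K$. Then, for every $\chi\in\widehat{\mathcal B}^+$, the induced representation $\mathrm{Ind}\,\chi$ of $\mathcal A$ is irreducible if and only if the stabilizer group $\mathrm{St}\,\chi$ is trivial. -/

import Mathlib

open scoped TensorProduct ComplexOrder

set_option linter.unusedSectionVars false

noncomputable section

universe u v w

/-! ## Unbounded `*`-representations -/

section StarRepresentations

variable {A : Type u} [Ring A] [StarRing A] [Algebra ℂ A] [StarModule ℂ A]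

/-- A `*`-representation of a `*`-algebra `A` on a dense linear subspace `domain` of a Hilbert
space `H`: an algebra homomorphism of `A` into the linear operators on `domain` such that
`⟨π(a)φ, ψ⟩ = ⟨φ, π(a*)ψ⟩`. -/
structure StarRep (A : Type u) [Ring A] [StarRing A] [Algebra ℂ A] [StarModule ℂ A]
    (H : Type w) [NormedAddCommGroup H] [InnerProductSpace ℂ H] where
  domain : Submodule ℂ H
  dense : Dense (domain : Set H)
  toHom : A →ₙₐ[ℂ] Module.End ℂ domain
  adjoint_rel : ∀ (a : A) (φ ψ : domain),
    inner ℂ (toHom a φ : H) (ψ : H) = inner ℂ (φ : H) (toHom (star a) ψ : H)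

namespace StarRep

variable {H : Type w} [NormedAddCommGroup H] [InnerProductSpace ℂ H]
variable {H₁ H₂ : Type w} [NormedAddCommGroup H₁] [InnerProductSpace ℂ H₁]
  [NormedAddCommGroup H₂] [InnerProductSpace ℂ H₂]

/-- Unitary equivalence: an isometric linear bijection of the domains which intertwines. -/
def UnitarilyEquivalent (π₁ : StarRep A H₁) (π₂ : StarRep A H₂) : Prop :=
  ∃ U : π₁.domain ≃ₗᵢ[ℂ] π₂.domain, ∀ (a : A) (φ : π₁.domain),
    U (π₁.toHom a φ) = π₂.toHom a (U φ)

/-- The domain `D(π₁) ⊕ D(π₂)` inside the Hilbert space direct sum `H₁ ⊕ H₂`. -/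
def sumDomain (D₁ : Submodule ℂ H₁) (D₂ : Submodule ℂ H₂) :
    Submodule ℂ (WithLp 2 (H₁ × H₂)) :=
  (D₁.prod D₂).comap (WithLp.linearEquiv 2 ℂ (H₁ × H₂)).toLinearMap

theorem mem_sumDomain {D₁ : Submodule ℂ H₁} {D₂ : Submodule ℂ H₂}
    {x : WithLp 2 (H₁ × H₂)} : x ∈ sumDomain D₁ D₂ ↔ x.fst ∈ D₁ ∧ x.snd ∈ D₂ := Iff.rfl

/-- The operator `S ⊕ T` on `D(π₁) ⊕ D(π₂)`. -/
def sumOp {D₁ : Submodule ℂ H₁} {D₂ : Submodule ℂ H₂}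
    (S : Module.End ℂ D₁) (T : Module.End ℂ D₂) : Module.End ℂ (sumDomain D₁ D₂) where
  toFun x := ⟨WithLp.toLp 2 ((S ⟨x.1.fst, x.2.1⟩ : H₁), (T ⟨x.1.snd, x.2.2⟩ : H₂)),
    (S _).2, (T _).2⟩
  map_add' x y := by
    have h1 := S.map_add ⟨x.1.fst, x.2.1⟩ ⟨y.1.fst, y.2.1⟩
    have h2 := T.map_add ⟨x.1.snd, x.2.2⟩ ⟨y.1.snd, y.2.2⟩
    apply Subtype.ext
    apply (WithLp.equiv 2 (H₁ × H₂)).injective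
    exact Prod.ext (congrArg Subtype.val h1) (congrArg Subtype.val h2)
  map_smul' c x := by
    have h1 := S.map_smul c ⟨x.1.fst, x.2.1⟩
    have h2 := T.map_smul c ⟨x.1.snd, x.2.2⟩
    apply Subtype.ext
    apply (WithLp.equiv 2 (H₁ × H₂)).injective
    exact Prod.ext (congrArg Subtype.val h1) (congrArg Subtype.val h2)

/-- The direct sum `π₁ ⊕ π₂`. -/
def directSum (π₁ : StarRep A H₁) (π₂ : StarRep A H₂) : StarRep A (WithLp 2 (H₁ × H₂)) where
  domain := sumDomain π₁.domain π₂.domain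
  dense := by
    have h := (π₁.dense.prod π₂.dense).preimage
      (WithLp.homeomorphProd 2 H₁ H₂).isOpenMap
    exact h
  toHom :=
    { toFun := fun a => sumOp (π₁.toHom a) (π₂.toHom a)
      map_smul' := fun c a => by
        ext x
        apply (WithLp.equiv 2 (H₁ × H₂)).injective
        simp [sumOp]
      map_zero' := by
        ext x
        apply (WithLp.equiv 2 (H₁ × H₂)).injective
        simp [sumOp]
      map_add' := fun a b => by
        ext x
        apply (WithLp.equiv 2 (H₁ × H₂)).injective
        simp [sumOp]
      map_mul' := fun a b => by
        ext x
        apply (WithLp.equiv 2 (H₁ × H₂)).injective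
        simp [sumOp] }
  adjoint_rel a φ ψ := by
    have h1 := π₁.adjoint_rel a ⟨φ.1.fst, φ.2.1⟩ ⟨ψ.1.fst, ψ.2.1⟩
    have h2 := π₂.adjoint_rel a ⟨φ.1.snd, φ.2.2⟩ ⟨ψ.1.snd, ψ.2.2⟩
    exact congrArg₂ (· + ·) h1 h2

/-- `π` is irreducible if a decomposition `π = π₁ ⊕ π₂` is possible only with `D(π₁) = {0}` or
`D(π₂) = {0}`. -/
def Irreducible (π : StarRep A H) : Prop :=
  ∀ (K₁ K₂ : Type w) [NormedAddCommGroup K₁] [InnerProductSpace ℂ K₁] [CompleteSpace K₁]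
    [NormedAddCommGroup K₂] [InnerProductSpace ℂ K₂] [CompleteSpace K₂]
    (π₁ : StarRep A K₁) (π₂ : StarRep A K₂),
    UnitarilyEquivalent π (directSum π₁ π₂) → π₁.domain = ⊥ ∨ π₂.domain = ⊥

/-! ### The closure of a `*`-representation

The graph topology on `D(π)` is the one induced by `φ ↦ (φ, (π(a)φ)_a) ∈ H × H^A`. The completion
of `D(π)` is the closure of the image; since all `π(a)` are closable, it embeds in `H` by the
first coordinate, and the coordinate `a` is then the value of the closure of `π(a)`. -/

variable (π : StarRep A H)

/-- `φ ↦ (φ, (π(a)φ)_a)`. -/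
def graphMap : π.domain →ₗ[ℂ] H × (A → H) :=
  π.domain.subtype.prod (LinearMap.pi fun a => π.domain.subtype ∘ₗ π.toHom a)

/-- The completion of `D(π)` in the graph topology (for complete `H`). -/
def closedGraph : Submodule ℂ (H × (A → H)) :=
  (LinearMap.range π.graphMap).topologicalClosure

theorem graphMap_mem (φ : π.domain) : π.graphMap φ ∈ π.closedGraph :=
  Submodule.le_topologicalClosure _ ⟨φ, rfl⟩

theorem closedGraph_induction {P : H × (A → H) → Prop} (hP : IsClosed {z | P z})
    (h : ∀ φ, P (π.graphMap φ)) {z : H × (A → H)} (hz : z ∈ π.closedGraph) : P z := by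
  have hsub : closure (LinearMap.range π.graphMap : Set (H × (A → H))) ⊆ {z | P z} :=
    closure_minimal (by rintro _ ⟨φ, rfl⟩; exact h φ) hP
  exact hsub hz

theorem closedGraph_adjoint {z y : H × (A → H)} (hz : z ∈ π.closedGraph)
    (hy : y ∈ π.closedGraph) (a : A) : inner ℂ (z.2 a) y.1 = inner ℂ z.1 (y.2 (star a)) := by
  refine π.closedGraph_induction (P := fun z => inner ℂ (z.2 a) y.1 = inner ℂ z.1 (y.2 (star a)))
    (isClosed_eq (by fun_prop) (by fun_prop)) (fun φ => ?_) hz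
  refine π.closedGraph_induction
    (P := fun y => inner ℂ ((π.graphMap φ).2 a) y.1 = inner ℂ (π.graphMap φ).1 (y.2 (star a)))
    (isClosed_eq (by fun_prop) (by fun_prop)) (fun ψ => ?_) hy
  exact π.adjoint_rel a φ ψ

/-- Restriction to the closed graph of the first projection. -/
def closedGraphFst : π.closedGraph →ₗ[ℂ] H := LinearMap.fst ℂ H (A → H) ∘ₗ π.closedGraph.subtype

theorem closedGraphFst_injective : Function.Injective π.closedGraphFst := by
  rw [← LinearMap.ker_eq_bot, LinearMap.ker_eq_bot']
  rintro ⟨⟨x, f⟩, hz⟩ (hx : x = 0)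
  subst hx
  have hf : f = 0 := by
    funext a
    refine π.dense.eq_zero_of_inner_right ℂ (fun v hv => ?_)
    have h := π.closedGraph_adjoint hz (π.graphMap_mem ⟨v, hv⟩) a
    rw [← inner_conj_symm]
    change (starRingEnd ℂ) (inner ℂ (f a) v) = 0
    change inner ℂ (f a) v = inner ℂ (0 : H) _ at h
    rw [h, inner_zero_left, map_zero]
  subst hf
  rfl

/-- `(x, f) ↦ (f(a), (f(ba))_b)`, which sends `(φ, (π(b)φ)_b)` to the same vector for `π(a)φ`. -/
def graphShift (a : A) : H × (A → H) →ₗ[ℂ] H × (A → H) where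
  toFun z := (z.2 a, fun b => z.2 (b * a))
  map_add' _ _ := rfl
  map_smul' _ _ := rfl

theorem graphShift_mem (a : A) {z : H × (A → H)} (hz : z ∈ π.closedGraph) :
    graphShift a z ∈ π.closedGraph := by
  refine π.closedGraph_induction (P := fun z => graphShift a z ∈ π.closedGraph) ?_ ?_ hz
  · refine (Submodule.isClosed_topologicalClosure _).preimage ?_
    change Continuous fun z : H × (A → H) => (z.2 a, fun b => z.2 (b * a))
    fun_prop
  · intro φ
    have : graphShift a (π.graphMap φ) = π.graphMap (π.toHom a φ) := by
      refine Prod.ext rfl (funext fun b => ?_)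
      change (π.toHom (b * a) φ : H) = (π.toHom b (π.toHom a φ) : H)
      rw [map_mul]; rfl
    rw [this]
    exact π.graphMap_mem _

/-- The domain `D(π̄) ⊆ H` of the closure. -/
def closureDomain : Submodule ℂ H := LinearMap.range π.closedGraphFst

/-- The identification of the completion of `D(π)` with `D(π̄)`. -/
def closureEquiv : π.closedGraph ≃ₗ[ℂ] π.closureDomain :=
  LinearEquiv.ofInjective π.closedGraphFst π.closedGraphFst_injective

/-- The operator `π̄(a)` on `D(π̄)`. -/
def closureOp (a : A) : Module.End ℂ π.closureDomain :=
  π.closureEquiv.conj ((graphShift a).restrict fun _ hz => π.graphShift_mem a hz)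

theorem closureOp_apply (a : A) (z : π.closedGraph) :
    (π.closureOp a (π.closureEquiv z) : H) = z.1.2 a := by
  simp only [closureOp, LinearEquiv.conj_apply_apply, LinearEquiv.symm_apply_apply]
  rfl

theorem closureOp_ext {S T : Module.End ℂ π.closureDomain}
    (h : ∀ z, (S (π.closureEquiv z) : H) = T (π.closureEquiv z)) : S = T := by
  ext x
  obtain ⟨z, rfl⟩ := π.closureEquiv.surjective x
  exact h z

/-- The closure `π̄` of a `*`-representation. -/
def closure : StarRep A H where
  domain := π.closureDomain
  dense := by
    refine π.dense.mono fun φ hφ => ?_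
    exact ⟨⟨π.graphMap ⟨φ, hφ⟩, π.graphMap_mem _⟩, rfl⟩
  toHom :=
    { toFun := π.closureOp
      map_smul' := fun c a => π.closureOp_ext fun z => by
        simp only [LinearMap.smul_apply, Submodule.coe_smul, closureOp_apply]
        refine π.closedGraph_induction (P := fun z => z.2 (c • a) = c • z.2 a)
          (isClosed_eq (by fun_prop) (by fun_prop)) (fun φ => ?_) z.2
        simp [graphMap]
      map_zero' := π.closureOp_ext fun z => by
        simp only [LinearMap.zero_apply, Submodule.coe_zero, closureOp_apply]
        refine π.closedGraph_induction (P := fun z => z.2 0 = 0)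
          (isClosed_eq (by fun_prop) (by fun_prop)) (fun φ => ?_) z.2
        simp [graphMap]
      map_add' := fun a b => π.closureOp_ext fun z => by
        simp only [LinearMap.add_apply, Submodule.coe_add, closureOp_apply]
        refine π.closedGraph_induction (P := fun z => z.2 (a + b) = z.2 a + z.2 b)
          (isClosed_eq (by fun_prop) (by fun_prop)) (fun φ => ?_) z.2
        simp [graphMap]
      map_mul' := fun a b => π.closureOp_ext fun z => by
        simp only [Module.End.mul_apply]
        have : π.closureOp b (π.closureEquiv z)
            = π.closureEquiv ⟨graphShift b z.1, π.graphShift_mem b z.2⟩ := by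
          simp only [closureOp, LinearEquiv.conj_apply_apply, LinearEquiv.symm_apply_apply]
          rfl
        rw [this, closureOp_apply, closureOp_apply]
        rfl }
  adjoint_rel a φ ψ := by
    obtain ⟨z, rfl⟩ := π.closureEquiv.surjective φ
    obtain ⟨y, rfl⟩ := π.closureEquiv.surjective ψ
    change inner ℂ (π.closureOp a (π.closureEquiv z) : H) _
      = inner ℂ _ (π.closureOp (star a) (π.closureEquiv y) : H)
    rw [closureOp_apply, closureOp_apply]
    exact π.closedGraph_adjoint z.2 y.2 a

end StarRep

end StarRepresentations

/-! ## Induced representations -/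

section Induction

variable {A : Type u} [Ring A] [StarRing A] [Algebra ℂ A] [StarModule ℂ A]

/-- A `B`-bimodule projection of `A` onto the unital `*`-subalgebra `B`. -/
structure BimoduleProjection (B : StarSubalgebra ℂ A) where
  toLin : A →ₗ[ℂ] B
  map_star : ∀ a, toLin (star a) = star (toLin a)
  map_mul : ∀ (b₁ b₂ : B) (a : A), toLin (b₁ * a * b₂) = b₁ * toLin a * b₂
  map_one : toLin 1 = 1

variable {B : StarSubalgebra ℂ A} (p : BimoduleProjection B)
variable {H : Type w} [NormedAddCommGroup H] [InnerProductSpace ℂ H] (ρ : StarRep B H)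

/-- For `y ∈ A`, `ψ ∈ D(ρ)`, the functional `x ⊗ φ ↦ ⟨ρ(p(y* x))φ, ψ⟩` on `A ⊗ D(ρ)` (the scalar
product being linear in `φ`, that is, in the second argument of `inner`). -/
def inductionFunctional (y : A) (ψ : ρ.domain) : A ⊗[ℂ] ρ.domain →ₗ[ℂ] ℂ :=
  TensorProduct.lift (LinearMap.mk₂ ℂ
    (fun x φ => inner ℂ (ψ : H) (ρ.toHom (p.toLin (star y * x)) φ : H))
    (fun x x' φ => by simp [mul_add])
    (fun c x φ => by simp)
    (fun x φ φ' => by simp)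
    (fun c x φ => by simp))

/-- The sesquilinear form on `A ⊗ D(ρ)` with
`inductionForm (∑ y_l ⊗ ψ_l) (∑ x_k ⊗ φ_k) = ∑_{k,l} ⟨ρ(p(y_l* x_k))φ_k, ψ_l⟩`,
conjugate-linear in the first and linear in the second argument. -/
def inductionForm : A ⊗[ℂ] ρ.domain →ₗ⋆[ℂ] A ⊗[ℂ] ρ.domain →ₗ[ℂ] ℂ :=
  TensorProduct.lift (LinearMap.mk₂'ₛₗ (starRingEnd ℂ) (starRingEnd ℂ)
    (inductionFunctional p ρ)
    (fun y y' ψ => by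
      ext x φ; simp [inductionFunctional, add_mul])
    (fun c y ψ => by
      ext x φ; simp [inductionFunctional])
    (fun y ψ ψ' => by
      ext x φ; simp [inductionFunctional])
    (fun c y ψ => by
      ext x φ; simp [inductionFunctional, mul_comm]))

theorem inductionForm_tmul (x y : A) (φ ψ : ρ.domain) :
    inductionForm p ρ (y ⊗ₜ ψ) (x ⊗ₜ φ)
      = inner ℂ (ψ : H) (ρ.toHom (p.toLin (star y * x)) φ : H) := rfl

theorem inductionForm_conj (η ζ : A ⊗[ℂ] ρ.domain) :
    starRingEnd ℂ (inductionForm p ρ ζ η) = inductionForm p ρ η ζ := by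
  induction η with
  | zero => simp
  | add η η' h h' => simp [h, h']
  | tmul x φ =>
    induction ζ with
    | zero => simp
    | add ζ ζ' h h' => simp [h, h']
    | tmul y ψ =>
      rw [inductionForm_tmul, inductionForm_tmul, inner_conj_symm, ρ.adjoint_rel, ← p.map_star]
      simp

/-- Left multiplication `x ⊗ φ ↦ ax ⊗ φ`. -/
def leftAction (D : Submodule ℂ H) (a : A) : Module.End ℂ (A ⊗[ℂ] D) :=
  (LinearMap.mulLeft ℂ a).rTensor D

theorem inductionForm_leftAction (a : A) (η ζ : A ⊗[ℂ] ρ.domain) :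
    inductionForm p ρ (leftAction ρ.domain a η) ζ
      = inductionForm p ρ η (leftAction ρ.domain (star a) ζ) := by
  induction η with
  | zero => simp
  | add η η' h h' => simp [h, h']
  | tmul x φ =>
    induction ζ with
    | zero => simp
    | add ζ ζ' h h' => simp [h, h']
    | tmul y ψ => simp [leftAction, inductionForm_tmul, mul_assoc]

/-- `ρ` is inducible from `B` to `A` if the form is nonnegative. -/
def Inducible : Prop := ∀ η, 0 ≤ inductionForm p ρ η η

/-- The space `A ⊗ D(ρ)` with the semi-inner product `inductionForm`. -/
@[nolint unusedArguments]
def IndPre (_h : Inducible p ρ) : Type (max u w) := A ⊗[ℂ] ρ.domain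

variable {p ρ} (h : Inducible p ρ)

instance : AddCommGroup (IndPre p ρ h) := inferInstanceAs (AddCommGroup (A ⊗[ℂ] ρ.domain))
instance : Module ℂ (IndPre p ρ h) := inferInstanceAs (Module ℂ (A ⊗[ℂ] ρ.domain))

/-- `inductionForm` viewed on `IndPre`. -/
def indForm : IndPre p ρ h →ₗ⋆[ℂ] IndPre p ρ h →ₗ[ℂ] ℂ := inductionForm p ρ

@[reducible] def indPreCore : PreInnerProductSpace.Core ℂ (IndPre p ρ h) where
  inner η ζ := indForm h η ζ
  conj_inner_symm η ζ := inductionForm_conj p ρ η ζ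
  re_inner_nonneg η := (Complex.le_def.mp (h η)).1
  add_left η η' ζ := by rw [map_add]; rfl
  smul_left η ζ c := by rw [LinearMap.map_smulₛₗ]; rfl

instance : SeminormedAddCommGroup (IndPre p ρ h) :=
  @InnerProductSpace.Core.toSeminormedAddCommGroup ℂ _ _ _ _ (indPreCore h)
instance : InnerProductSpace ℂ (IndPre p ρ h) := InnerProductSpace.ofCore (indPreCore h)

theorem indPre_inner (η ζ : IndPre p ρ h) : inner ℂ η ζ = indForm h η ζ := rfl

/-- The Hilbert space of the induced representation: the completion of the quotient of
`A ⊗ D(ρ)` by the kernel of the semi-inner product. -/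
abbrev IndSpace : Type (max u w) := UniformSpace.Completion (IndPre p ρ h)

/-- `η ↦ [η]`. -/
def indMk : IndPre p ρ h →ₗ[ℂ] IndSpace h :=
  (UniformSpace.Completion.toComplL (𝕜 := ℂ) (E := IndPre p ρ h)).toLinearMap

theorem indMk_inner (η ζ : IndPre p ρ h) :
    inner ℂ (indMk h η) (indMk h ζ) = indForm h η ζ :=
  UniformSpace.Completion.inner_coe η ζ

/-- Left multiplication on `A ⊗ D(ρ)` viewed as a semi-inner product space. -/
def indAct (a : A) : Module.End ℂ (IndPre p ρ h) := leftAction ρ.domain a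

theorem indAct_inner (a : A) (η ζ : IndPre p ρ h) :
    inner ℂ (indMk h (indAct h a η)) (indMk h ζ)
      = inner ℂ (indMk h η) (indMk h (indAct h (star a) ζ)) := by
  rw [indMk_inner, indMk_inner]
  exact inductionForm_leftAction p ρ a η ζ

theorem indAct_ker (a : A) :
    LinearMap.ker (indMk h) ≤ (LinearMap.ker (indMk h)).comap (indAct h a) := by
  intro η hη
  rw [LinearMap.mem_ker] at hη
  rw [Submodule.mem_comap, LinearMap.mem_ker, ← inner_self_eq_zero (𝕜 := ℂ), indAct_inner, hη,
    inner_zero_left]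

/-- `π₀(a)[η] = [aη]` on `D(π₀) = (A ⊗ D(ρ))/K_ρ`. -/
def indOp (a : A) : Module.End ℂ (LinearMap.range (indMk h)) :=
  (indMk h).quotKerEquivRange.conj
    ((LinearMap.ker (indMk h)).mapQ _ (indAct h a) (indAct_ker h a))

theorem indOp_apply (a : A) (η : IndPre p ρ h) :
    indOp h a ⟨indMk h η, η, rfl⟩ = ⟨indMk h (indAct h a η), _, rfl⟩ := by
  have key : ∀ ζ : IndPre p ρ h, (indMk h).quotKerEquivRange (Submodule.Quotient.mk ζ)
      = ⟨indMk h ζ, ζ, rfl⟩ := fun ζ => rfl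
  rw [← key, ← key, indOp, LinearEquiv.conj_apply_apply, LinearEquiv.symm_apply_apply]
  rfl

theorem indAct_smul (c : ℂ) (a : A) : indAct h (c • a) = c • indAct h a := by
  have : leftAction ρ.domain (c • a) = c • leftAction ρ.domain a := by
    refine TensorProduct.ext' fun x φ => ?_
    simp [leftAction, TensorProduct.smul_tmul']
  exact this

theorem indAct_zero : indAct h (0 : A) = 0 := by
  have : leftAction ρ.domain (0 : A) = 0 := by
    refine TensorProduct.ext' fun x φ => ?_
    simp [leftAction]
  exact this

theorem indAct_add (a b : A) : indAct h (a + b) = indAct h a + indAct h b := by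
  have : leftAction ρ.domain (a + b) = leftAction ρ.domain a + leftAction ρ.domain b := by
    refine TensorProduct.ext' fun x φ => ?_
    simp [leftAction, add_mul, TensorProduct.add_tmul]
  exact this

theorem indAct_mul (a b : A) : indAct h (a * b) = indAct h a * indAct h b := by
  have : leftAction ρ.domain (a * b) = leftAction ρ.domain a * leftAction ρ.domain b := by
    refine TensorProduct.ext' fun x φ => ?_
    simp [leftAction]
  exact this

/-- The `*`-representation `π₀` of `A` on `D(π₀)`. -/
def indRep₀ : StarRep A (IndSpace h) where
  domain := LinearMap.range (indMk h)
  dense := by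
    have hd : DenseRange ((↑) : IndPre p ρ h → IndSpace h) :=
      UniformSpace.Completion.denseRange_coe
    rw [LinearMap.coe_range]
    exact hd
  toHom :=
    { toFun := indOp h
      map_smul' := fun c a => by
        ext ⟨_, η, rfl⟩
        simp [indOp_apply, indAct_smul]
      map_zero' := by
        ext ⟨_, η, rfl⟩
        simp [indOp_apply, indAct_zero]
      map_add' := fun a b => by
        ext ⟨_, η, rfl⟩
        simp [indOp_apply, indAct_add]
      map_mul' := fun a b => by
        ext ⟨_, η, rfl⟩
        simp [indOp_apply, indAct_mul] }
  adjoint_rel a φ ψ := by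
    obtain ⟨_, η, rfl⟩ := φ
    obtain ⟨_, ζ, rfl⟩ := ψ
    change inner ℂ (indOp h a _ : IndSpace h) _ = inner ℂ _ (indOp h (star a) _ : IndSpace h)
    rw [indOp_apply, indOp_apply]
    exact indAct_inner h a η ζ

/-- The induced representation `Ind ρ`: the closure of `π₀`. -/
def indRep : StarRep A (IndSpace h) := (indRep₀ h).closure

end Induction

/-! ## Group graded `*`-algebras and the partial action on positive characters -/

section Graded

variable {A : Type u} [Ring A] [StarRing A] [Algebra ℂ A] [StarModule ℂ A]
variable {G : Type v} [Group G] [DecidableEq G]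

/-- A `G`-grading of the `*`-algebra `A`: `A = ⨁_g A_g` as vector spaces, `A_g A_h ⊆ A_{gh}` and
`(A_g)* ⊆ A_{g⁻¹}`. -/
class StarGrading (𝒜 : G → Submodule ℂ A) : Prop where
  isInternal : DirectSum.IsInternal 𝒜
  mul_mem : ∀ {g h : G} {a b : A}, a ∈ 𝒜 g → b ∈ 𝒜 h → a * b ∈ 𝒜 (g * h)
  star_mem : ∀ {g : G} {a : A}, a ∈ 𝒜 g → star a ∈ 𝒜 g⁻¹

namespace StarGrading

variable (𝒜 : G → Submodule ℂ A) [StarGrading 𝒜]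

/-- The isomorphism `⨁_g A_g ≃ A`. -/
def sumEquiv : DirectSum G (fun i => 𝒜 i) ≃ₗ[ℂ] A :=
  LinearEquiv.ofBijective (DirectSum.coeLinearMap 𝒜) (StarGrading.isInternal (𝒜 := 𝒜))

theorem sumEquiv_lof (h : G) (x : 𝒜 h) :
    sumEquiv 𝒜 (DirectSum.lof ℂ G (fun i => 𝒜 i) h x) = x :=
  DirectSum.coeLinearMap_lof 𝒜 h x

/-- The homogeneous component `a ↦ a_g`. -/
def component (g : G) : A →ₗ[ℂ] 𝒜 g :=
  DirectSum.component ℂ G (fun i => 𝒜 i) g ∘ₗ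
    (sumEquiv 𝒜).symm.toLinearMap

theorem component_coe (g h : G) (x : 𝒜 h) :
    component 𝒜 g (x : A) = DirectSum.component ℂ G (fun i => 𝒜 i) g
      (DirectSum.lof ℂ G (fun i => 𝒜 i) h x) := by
  simp only [component, LinearMap.comp_apply]
  congr 1
  rw [LinearEquiv.coe_coe, LinearEquiv.symm_apply_eq, sumEquiv_lof]

theorem component_self {g : G} {x : A} (hx : x ∈ 𝒜 g) : (component 𝒜 g x : A) = x := by
  have := component_coe 𝒜 g g ⟨x, hx⟩
  rw [DirectSum.component.lof_self] at this
  exact congrArg Subtype.val this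

theorem component_ne {g h : G} (hgh : h ≠ g) {x : A} (hx : x ∈ 𝒜 h) :
    component 𝒜 g x = 0 := by
  have := component_coe 𝒜 g h ⟨x, hx⟩
  rw [DirectSum.component.of, dif_neg hgh] at this
  exact this

theorem homogeneous_induction {P : A → Prop} (a : A) (hom : ∀ g, ∀ x ∈ 𝒜 g, P x)
    (zero : P 0) (add : ∀ x y, P x → P y → P (x + y)) : P a := by
  have ha : a ∈ ⨆ g, 𝒜 g := by
    rw [(StarGrading.isInternal (𝒜 := 𝒜)).submodule_iSup_eq_top]; trivial
  exact Submodule.iSup_induction 𝒜 (motive := P) ha hom zero add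

theorem component_mul_left {h : G} {a : A} (ha : a ∈ 𝒜 h) (x : A) :
    (component 𝒜 h (a * x) : A) = a * component 𝒜 1 x := by
  refine homogeneous_induction 𝒜
    (P := fun x => (component 𝒜 h (a * x) : A) = a * component 𝒜 1 x) x (fun k x hx => ?_) (by simp)
    (fun x y hx hy => by simp [mul_add, hx, hy])
  by_cases hk : k = 1
  · subst hk
    have hax := mul_mem ha hx
    rw [mul_one] at hax
    rw [component_self 𝒜 hax, component_self 𝒜 hx]
  · rw [component_ne 𝒜 (by simpa using hk) (mul_mem ha hx), component_ne 𝒜 hk hx]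
    simp

theorem one_mem : (1 : A) ∈ 𝒜 1 := by
  have key : ∀ a : A, a = a * component 𝒜 1 1 := fun a => by
    refine homogeneous_induction 𝒜 (P := fun a => a = a * component 𝒜 1 1) a (fun h a ha => ?_) (by simp)
      (fun x y hx hy => by rw [add_mul, ← hx, ← hy])
    rw [← component_mul_left 𝒜 ha, mul_one, component_self 𝒜 ha]
  have h1 := key 1
  rw [one_mul] at h1
  rw [h1]
  exact (component 𝒜 1 1).2

/-- The unital `*`-subalgebra `B = A_e`. -/
def base : StarSubalgebra ℂ A where
  carrier := 𝒜 1
  mul_mem' ha hb := by simpa using mul_mem ha hb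
  one_mem' := one_mem 𝒜
  add_mem' ha hb := (𝒜 1).add_mem ha hb
  zero_mem' := (𝒜 1).zero_mem
  algebraMap_mem' r := by
    rw [Algebra.algebraMap_eq_smul_one]
    exact (𝒜 1).smul_mem r (one_mem 𝒜)
  star_mem' ha := by simpa using star_mem ha

/-- The canonical conditional expectation `p : A → B`, `p(a) = a_e`. -/
def canonicalProjection : BimoduleProjection (base 𝒜) where
  toLin :=
    { toFun := fun a => ⟨component 𝒜 1 a, (component 𝒜 1 a).2⟩
      map_add' := fun a b => Subtype.ext (by simp)
      map_smul' := fun c a => Subtype.ext (by simp) }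
  map_star a := by
    apply Subtype.ext
    change (component 𝒜 1 (star a) : A) = star (component 𝒜 1 a : A)
    refine homogeneous_induction 𝒜
      (P := fun a => (component 𝒜 1 (star a) : A) = star (component 𝒜 1 a : A)) a (fun g x hx => ?_) (by simp)
      (fun x y hx hy => by simp [hx, hy])
    by_cases hg : g = 1
    · subst hg
      have hs := star_mem hx
      rw [inv_one] at hs
      rw [component_self 𝒜 hx, component_self 𝒜 hs]
    · rw [component_ne 𝒜 hg hx, component_ne 𝒜 (by simpa using hg) (star_mem hx)]
      simp
  map_mul b₁ b₂ a := by
    obtain ⟨b₁, h₁⟩ := b₁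
    obtain ⟨b₂, h₂⟩ := b₂
    apply Subtype.ext
    change (component 𝒜 1 (b₁ * a * b₂) : A) = b₁ * (component 𝒜 1 a : A) * b₂
    refine homogeneous_induction 𝒜
      (P := fun a => (component 𝒜 1 (b₁ * a * b₂) : A) = b₁ * (component 𝒜 1 a : A) * b₂) a (fun g x hx => ?_) (by simp)
      (fun x y hx hy => by simp [mul_add, add_mul, hx, hy])
    have hm : b₁ * x * b₂ ∈ 𝒜 g := by simpa using mul_mem (mul_mem h₁ hx) h₂
    by_cases hg : g = 1
    · subst hg
      rw [component_self 𝒜 hx, component_self 𝒜 hm]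
    · rw [component_ne 𝒜 hg hx, component_ne 𝒜 hg hm]
      simp
  map_one := Subtype.ext (component_self 𝒜 (one_mem 𝒜))

theorem canonicalProjection_apply (a : A) :
    ((canonicalProjection 𝒜).toLin a : A) = component 𝒜 1 a := rfl

end StarGrading

/-- The cone `∑ A²` of finite sums of squares `a* a`. -/
def sumSquares (A : Type u) [Ring A] [StarRing A] : AddSubmonoid A :=
  AddSubmonoid.closure (Set.range fun a : A => star a * a)

open StarGrading

variable (𝒜 : G → Submodule ℂ A) [StarGrading 𝒜]

theorem canonicalProjection_mem_sumSquares (a : A) :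
    ((canonicalProjection 𝒜).toLin (star a * a) : A) ∈ sumSquares A := by
  classical
  obtain ⟨x, rfl⟩ := (StarGrading.isInternal (𝒜 := 𝒜)).surjective a
  rw [canonicalProjection_apply, DirectSum.coeAddMonoidHom_eq_dfinsuppSum, DFinsupp.sum,
    star_sum, Finset.sum_mul, map_sum, Submodule.coe_sum]
  refine AddSubmonoid.sum_mem _ fun i hi => ?_
  rw [Finset.mul_sum, map_sum, Finset.sum_eq_single i]
  · have hm := mul_mem (𝒜 := 𝒜) (star_mem (x i).2) (x i).2
    rw [inv_mul_cancel] at hm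
    rw [component_self 𝒜 hm]
    exact AddSubmonoid.subset_closure ⟨_, rfl⟩
  · intro j _ hj
    refine component_ne 𝒜 ?_ (mul_mem (star_mem (x i).2) (x j).2)
    intro h
    exact hj (inv_mul_eq_one.mp h).symm
  · intro h
    exact absurd hi h

theorem sandwich_mem_sumSquares {b : A} (hb : b ∈ sumSquares A) (a : A) :
    star a * b * a ∈ sumSquares A := by
  induction hb using AddSubmonoid.closure_induction with
  | mem x hx =>
    obtain ⟨c, rfl⟩ := hx
    exact AddSubmonoid.subset_closure ⟨c * a, by simp [mul_assoc]⟩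
  | zero => simp
  | add x y _ _ hx hy =>
    rw [mul_add, add_mul]
    exact add_mem hx hy

/-- `B̂⁺`: the characters (unital `*`-homomorphisms `B → ℂ`; for the unital algebra `B` this is the
same as nonzero `*`-homomorphisms) which are nonnegative on `∑ A² ∩ B`. -/
structure PosCharacter where
  toChar : base 𝒜 →⋆ₐ[ℂ] ℂ
  nonneg : ∀ b : base 𝒜, (b : A) ∈ sumSquares A → 0 ≤ toChar b

variable {𝒜}

theorem PosCharacter.ext' {χ ψ : PosCharacter 𝒜} (h : ∀ b, χ.toChar b = ψ.toChar b) : χ = ψ := by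
  cases χ; cases ψ
  congr
  exact StarAlgHom.ext h

/-- `c* d ∈ B` for `c, d ∈ A_g`. -/
def gradedInner {g : G} (c d : 𝒜 g) : base 𝒜 :=
  ⟨star (c : A) * d, by
    have h := mul_mem (𝒜 := 𝒜) (star_mem c.2) d.2
    rw [inv_mul_cancel] at h
    exact h⟩

/-- `a* b a ∈ B` for `a ∈ A_g` and `b ∈ B`. -/
def sandwich {g : G} (a : 𝒜 g) (b : base 𝒜) : base 𝒜 :=
  ⟨star (a : A) * b * a, by
    have h := mul_mem (𝒜 := 𝒜) (mul_mem (star_mem a.2) b.2) a.2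
    rw [mul_one, inv_mul_cancel] at h
    exact h⟩

/-- The condition `χ(c* d) χ(d* c) = χ(c* c) χ(d* d)` for all `χ ∈ B̂⁺`, `g ∈ G`, `c, d ∈ A_g`. -/
def CompatibleCharacters (𝒜 : G → Submodule ℂ A) [StarGrading 𝒜] : Prop :=
  ∀ (χ : PosCharacter 𝒜) (g : G) (c d : 𝒜 g),
    χ.toChar (gradedInner c d) * χ.toChar (gradedInner d c)
      = χ.toChar (gradedInner c c) * χ.toChar (gradedInner d d)

namespace PosCharacter

theorem gradedInner_nonneg (χ : PosCharacter 𝒜) {g : G} (a : 𝒜 g) :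
    0 ≤ χ.toChar (gradedInner a a) :=
  χ.nonneg _ (AddSubmonoid.subset_closure ⟨(a : A), rfl⟩)

/-- `χ^g` is defined if `χ(a* a) ≠ 0` for some `a ∈ A_g`. -/
def ActDefined (χ : PosCharacter 𝒜) (g : G) : Prop :=
  ∃ a : 𝒜 g, χ.toChar (gradedInner a a) ≠ 0

variable [IsMulCommutative (base 𝒜)]

theorem base_comm (b c : base 𝒜) : b * c = c * b :=
  IsMulCommutative.is_comm.comm b c

/-- The character `b ↦ χ(a* b a) / χ(a* a)` for `a ∈ A_g` with `χ(a* a) ≠ 0`. -/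
def actBy (χ : PosCharacter 𝒜) {g : G} (a : 𝒜 g) (ha : χ.toChar (gradedInner a a) ≠ 0) :
    PosCharacter 𝒜 where
  toChar :=
    { toFun := fun b => χ.toChar (sandwich a b) / χ.toChar (gradedInner a a)
      map_one' := by
        have : sandwich a (1 : base 𝒜) = gradedInner a a := by
          apply Subtype.ext; simp [sandwich, gradedInner]
        rw [this, div_self ha]
      map_mul' := fun b c => by
        have key : gradedInner a a * sandwich a (b * c) = sandwich a b * sandwich a c := by
          have hm : (a : A) * star (a : A) ∈ base 𝒜 := by
            have h := mul_mem (𝒜 := 𝒜) a.2 (star_mem a.2)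
            rw [mul_inv_cancel] at h
            exact h
          have hc := congrArg Subtype.val (base_comm ⟨_, hm⟩ b)
          change (a : A) * star (a : A) * b = b * (a * star (a : A)) at hc
          apply Subtype.ext
          change star (a : A) * a * (star (a : A) * (b * c) * a)
            = star (a : A) * b * a * (star (a : A) * c * a)
          calc star (a : A) * a * (star (a : A) * (b * c) * a)
              = star (a : A) * (a * star (a : A) * b) * c * a := by simp only [mul_assoc]
            _ = star (a : A) * b * a * (star (a : A) * c * a) := by
              rw [hc]; simp only [mul_assoc]
        have key' := congrArg χ.toChar key
        rw [map_mul, map_mul] at key'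
        field_simp
        rw [mul_comm, key']
      map_zero' := by
        have : sandwich a (0 : base 𝒜) = 0 := by apply Subtype.ext; simp [sandwich]
        rw [this, map_zero, zero_div]
      map_add' := fun b c => by
        have : sandwich a (b + c) = sandwich a b + sandwich a c := by
          apply Subtype.ext; simp [sandwich, mul_add, add_mul]
        rw [this, map_add, add_div]
      commutes' := fun r => by
        have : sandwich a (algebraMap ℂ (base 𝒜) r) = r • gradedInner a a := by
          apply Subtype.ext
          change star (a : A) * algebraMap ℂ A r * a = r • (star (a : A) * a)
          rw [Algebra.algebraMap_eq_smul_one]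
          simp
        rw [this, map_smul, smul_eq_mul, mul_div_assoc, div_self ha, mul_one]
        rfl
      map_star' := fun b => by
        have : sandwich a (star b) = star (sandwich a b) := by
          apply Subtype.ext
          change star (a : A) * star (b : A) * a = star (star (a : A) * b * a)
          simp [mul_assoc]
        have hs : star (χ.toChar (gradedInner a a)) = χ.toChar (gradedInner a a) := by
          rw [← map_star]
          congr 1
          apply Subtype.ext
          change star (star (a : A) * a) = star (a : A) * a
          simp
        rw [this, map_star, star_div₀, hs] }
  nonneg b hb := by
    change 0 ≤ χ.toChar (sandwich a b) / χ.toChar (gradedInner a a)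
    have h1 := χ.nonneg (sandwich a b) (sandwich_mem_sumSquares hb (a : A))
    have h2 := χ.gradedInner_nonneg a
    rw [div_eq_mul_inv]
    exact mul_nonneg h1 (inv_nonneg.mpr h2)

theorem actBy_apply (χ : PosCharacter 𝒜) {g : G} (a : 𝒜 g)
    (ha : χ.toChar (gradedInner a a) ≠ 0) (b : base 𝒜) :
    (χ.actBy a ha).toChar b = χ.toChar (sandwich a b) / χ.toChar (gradedInner a a) := rfl

/-- `χ^g(b) = χ(a* b a) / χ(a* a)`, where `a ∈ A_g` is any element with `χ(a* a) ≠ 0`; see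
`act_eq_actBy` for the independence of the choice of `a`. -/
def act (χ : PosCharacter 𝒜) (g : G) (h : χ.ActDefined g) : PosCharacter 𝒜 :=
  χ.actBy h.choose h.choose_spec

theorem act_eq_actBy (χ : PosCharacter 𝒜) (g : G) (h : χ.ActDefined g) (d : 𝒜 g)
    (hd : χ.toChar (gradedInner d d) ≠ 0) : χ.act g h = χ.actBy d hd := by
  refine PosCharacter.ext' fun b => ?_
  have hc := h.choose_spec
  set c := h.choose with hc'
  change χ.toChar (sandwich c b) / χ.toChar (gradedInner c c) = _
  rw [actBy_apply, div_eq_div_iff hc hd, ← map_mul, ← map_mul]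
  rw [base_comm (sandwich d b)]
  congr 1
  have hm : (c : A) * star (d : A) ∈ base 𝒜 := by
    have h := mul_mem (𝒜 := 𝒜) c.2 (star_mem d.2)
    rw [mul_inv_cancel] at h
    exact h
  have hcomm := congrArg Subtype.val (base_comm ⟨_, hm⟩ b)
  change (c : A) * star (d : A) * b = b * (c * star (d : A)) at hcomm
  apply Subtype.ext
  change star (c : A) * b * c * (star (d : A) * d) = star (c : A) * c * (star (d : A) * b * d)
  calc star (c : A) * b * c * (star (d : A) * d)
      = star (c : A) * (b * (c * star (d : A))) * d := by simp only [mul_assoc]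
    _ = star (c : A) * c * (star (d : A) * b * d) := by rw [← hcomm]; simp only [mul_assoc]

theorem exists_act_eq_iff (χ : PosCharacter 𝒜) (g : G) :
    (∃ h : χ.ActDefined g, χ.act g h = χ) ↔
      ∃ a : 𝒜 g, χ.toChar (gradedInner a a) ≠ 0 ∧
        ∀ b, χ.toChar (sandwich a b) = χ.toChar b * χ.toChar (gradedInner a a) := by
  constructor
  · rintro ⟨h, he⟩
    obtain ⟨a, ha⟩ := id h
    refine ⟨a, ha, fun b => ?_⟩
    rw [act_eq_actBy χ g h a ha] at he
    have := congrArg (fun ψ : PosCharacter 𝒜 => ψ.toChar b) he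
    simp only [actBy_apply] at this
    rwa [div_eq_iff ha] at this
  · rintro ⟨a, ha, hb⟩
    have h : χ.ActDefined g := ⟨a, ha⟩
    refine ⟨h, ?_⟩
    rw [act_eq_actBy χ g h a ha]
    refine PosCharacter.ext' fun b => ?_
    rw [actBy_apply, hb, mul_div_assoc, div_self ha, mul_one]

/-- The stabilizer group `St χ = {g | χ^g is defined and equal to χ}`. -/
def stabilizer (χ : PosCharacter 𝒜) : Subgroup G where
  carrier := {g | ∃ h : χ.ActDefined g, χ.act g h = χ}
  one_mem' := by
    refine (χ.exists_act_eq_iff 1).mpr ⟨⟨1, StarGrading.one_mem 𝒜⟩, ?_, fun b => ?_⟩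
    · have : gradedInner (𝒜 := 𝒜) (g := 1) ⟨1, StarGrading.one_mem 𝒜⟩ ⟨1, StarGrading.one_mem 𝒜⟩
          = 1 := by apply Subtype.ext; simp [gradedInner]
      rw [this, map_one]
      exact one_ne_zero
    · rw [← map_mul]
      congr 1
      apply Subtype.ext
      simp [gradedInner, sandwich]
  mul_mem' := by
    intro g h hg hh
    obtain ⟨a, ha, hab⟩ := (χ.exists_act_eq_iff g).mp hg
    obtain ⟨c, hc, hcb⟩ := (χ.exists_act_eq_iff h).mp hh
    have e2 : ∀ b, sandwich (𝒜 := 𝒜) (g := g * h) ⟨(a : A) * c, mul_mem a.2 c.2⟩ b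
        = sandwich c (sandwich a b) := fun b => by
      apply Subtype.ext; simp [sandwich, mul_assoc]
    have e1 : gradedInner (𝒜 := 𝒜) (g := g * h) ⟨(a : A) * c, mul_mem a.2 c.2⟩
        ⟨(a : A) * c, mul_mem a.2 c.2⟩ = sandwich c (gradedInner a a) := by
      apply Subtype.ext; simp [sandwich, gradedInner, mul_assoc]
    refine (χ.exists_act_eq_iff (g * h)).mpr ⟨⟨(a : A) * c, mul_mem a.2 c.2⟩, ?_, fun b => ?_⟩
    · rw [e1, hcb]
      exact mul_ne_zero ha hc
    · rw [e1, e2, hcb, hcb, hab, mul_assoc]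
  inv_mem' := by
    intro g hg
    obtain ⟨a, ha, hab⟩ := (χ.exists_act_eq_iff g).mp hg
    have e : ∀ b, sandwich a (sandwich (𝒜 := 𝒜) (g := g⁻¹) ⟨star (a : A), star_mem a.2⟩ b)
        = gradedInner a a * b * gradedInner a a := fun b => by
      apply Subtype.ext; simp [sandwich, gradedInner, mul_assoc]
    have hs : ∀ b, χ.toChar (sandwich (𝒜 := 𝒜) (g := g⁻¹) ⟨star (a : A), star_mem a.2⟩ b)
        = χ.toChar b * χ.toChar (gradedInner a a) := fun b => by
      have h := hab (sandwich (𝒜 := 𝒜) (g := g⁻¹) ⟨star (a : A), star_mem a.2⟩ b)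
      rw [e, map_mul, map_mul] at h
      rw [← mul_right_cancel₀ ha h]
      ring
    have e1 : gradedInner (𝒜 := 𝒜) (g := g⁻¹) ⟨star (a : A), star_mem a.2⟩
        ⟨star (a : A), star_mem a.2⟩
        = sandwich (𝒜 := 𝒜) (g := g⁻¹) ⟨star (a : A), star_mem a.2⟩ 1 := by
      apply Subtype.ext; simp [sandwich, gradedInner]
    have h1 : χ.toChar (gradedInner (𝒜 := 𝒜) (g := g⁻¹) ⟨star (a : A), star_mem a.2⟩
        ⟨star (a : A), star_mem a.2⟩) = χ.toChar (gradedInner a a) := by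
      rw [e1, hs, map_one, one_mul]
    refine (χ.exists_act_eq_iff g⁻¹).mpr ⟨⟨star (a : A), star_mem a.2⟩, ?_, fun b => ?_⟩
    · rw [h1]; exact ha
    · rw [h1, hs]

end PosCharacter

/-! ### Induction of positive characters -/

/-- A character as a one-dimensional `*`-representation of `B` on `ℂ`. -/
def charRep (χ : base 𝒜 →⋆ₐ[ℂ] ℂ) : StarRep (base 𝒜) ℂ where
  domain := ⊤
  dense := by simp
  toHom :=
    { toFun := fun b => χ b • (1 : Module.End ℂ (⊤ : Submodule ℂ ℂ))
      map_smul' := fun c b => by rw [map_smul, smul_assoc]; rfl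
      map_zero' := by rw [map_zero, zero_smul]
      map_add' := fun b c => by rw [map_add, add_smul]
      map_mul' := fun b c => by rw [map_mul, smul_mul_smul_comm, one_mul] }
  adjoint_rel b φ ψ := by
    change inner ℂ (χ b • (φ : ℂ)) (ψ : ℂ) = inner ℂ (φ : ℂ) (χ (star b) • (ψ : ℂ))
    rw [inner_smul_left, inner_smul_right, map_star]
    rfl

/-- `x ⊗ t ↦ t x`. -/
def charMul (χ : base 𝒜 →⋆ₐ[ℂ] ℂ) : A ⊗[ℂ] (charRep χ).domain →ₗ[ℂ] A :=
  TensorProduct.lift (LinearMap.mk₂ ℂ (fun (x : A) (t : (charRep χ).domain) => (t : ℂ) • x)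
    (fun _ _ _ => smul_add _ _ _) (fun _ _ _ => smul_comm _ _ _)
    (fun _ _ _ => add_smul _ _ _) (fun _ _ _ => smul_assoc _ _ _))

theorem inductionForm_charRep (χ : base 𝒜 →⋆ₐ[ℂ] ℂ) (η ζ : A ⊗[ℂ] (charRep χ).domain) :
    inductionForm (canonicalProjection 𝒜) (charRep χ) η ζ
      = χ ((canonicalProjection 𝒜).toLin (star (charMul χ η) * charMul χ ζ)) := by
  induction η with
  | zero => simp
  | add η η' h h' => simp [h, h', add_mul]
  | tmul x s =>
    induction ζ with
    | zero => simp
    | add ζ ζ' h h' => simp [h, h', mul_add]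
    | tmul y t =>
      rw [inductionForm_tmul]
      change inner ℂ (s : ℂ) (χ _ • (t : ℂ)) = χ ((canonicalProjection 𝒜).toLin
        (star ((s : ℂ) • x) * ((t : ℂ) • y)))
      rw [star_smul, smul_mul_smul_comm, map_smul, map_smul, inner_smul_right]
      simp
      ring

/-- Every character in `B̂⁺` is inducible. -/
theorem PosCharacter.inducible (χ : PosCharacter 𝒜) :
    Inducible (canonicalProjection 𝒜) (charRep χ.toChar) := fun η => by
  rw [inductionForm_charRep]
  exact χ.nonneg _ (canonicalProjection_mem_sumSquares 𝒜 _)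

/-- The induced representation `Ind χ` of `A` for `χ ∈ B̂⁺`. -/
def PosCharacter.ind (χ : PosCharacter 𝒜) : StarRep A (IndSpace χ.inducible) :=
  indRep χ.inducible

end Graded

end

universe u v w

noncomputable section

/-! Write `[x]` for `χ.vec x`. The algebra acts by left multiplication on these vectors, the
homogeneous components are mutually orthogonal, and for `c ∈ A_g` with `χ(c*c) ≠ 0` the vector `[c]`
is a weight vector of `B` with weight `χ^g` (`vec_base_mul`).

Trivial stabilizer implies irreducible: weight vectors of different weights are orthogonal, so the
weight space of `χ` is the line through the cyclic vector `[1]` (`eq_smul_vec_one`). The projection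
onto a direct summand commutes with the representation, so it preserves this line, acts on it by a
scalar, and by cyclicity and continuity is that scalar everywhere. Hence one summand vanishes.

Nontrivial stabilizer implies reducible: for `g ≠ 1` in the stabilizer, some `a ∈ A_g` can be scaled
so that `χ(a*ba) = χ(b)` for all `b`. Then `[x] ↦ [xa]` is unitary with inverse `[x] ↦ [xa*]`,
commutes with left multiplication, and is not scalar because `[a] ⟂ [1]`. A form of Schur's lemma
for unbounded closures (`not_irreducible_closure`) finishes. It avoids spectral projections: a
continuous function of the operator is a contraction `S` in the norm-closed commutant, and the mean
ergodic theorem exhibits the projection onto its fixed space as a strong limit of averages of powers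
of `S`. Strong limits preserve the closed graph, so this fixed space reduces the closure. -/

namespace StarRep

variable {A : Type u} [Ring A] [StarRing A] [Algebra ℂ A] [StarModule ℂ A]
variable {H : Type w} [NormedAddCommGroup H] [InnerProductSpace ℂ H]

/-! ### Reducing subspaces -/

/-- `K` reduces `π` if the orthogonal projection onto `K` maps `D(π)` into itself and commutes
with all `π(a)`. -/
def Reduces (π : StarRep A H) (K : Submodule ℂ H) [K.HasOrthogonalProjection] : Prop :=
  ∀ φ : π.domain, ∃ h : K.starProjection φ ∈ π.domain,
    ∀ a, (π.toHom a ⟨K.starProjection φ, h⟩ : H) = K.starProjection (π.toHom a φ)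

namespace Reduces

variable {π : StarRep A H} {K : Submodule ℂ H} [K.HasOrthogonalProjection]

theorem orthogonal (hK : π.Reduces K) : π.Reduces Kᗮ := by
  intro φ
  obtain ⟨h, hc⟩ := hK φ
  have e : Kᗮ.starProjection (φ : H) = φ - K.starProjection φ :=
    K.starProjection_orthogonal_val φ
  have hm : Kᗮ.starProjection (φ : H) ∈ π.domain := e ▸ π.domain.sub_mem φ.2 h
  refine ⟨hm, fun a => ?_⟩
  have e' : (⟨_, hm⟩ : π.domain) = φ - ⟨_, h⟩ := Subtype.ext e
  rw [e', map_sub, Submodule.coe_sub, hc, K.starProjection_orthogonal_val]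

theorem toHom_mem (hK : π.Reduces K) (a : A) (φ : π.domain) (hφ : (φ : H) ∈ K) :
    (π.toHom a φ : H) ∈ K := by
  obtain ⟨h, hc⟩ := hK φ
  have e : (⟨K.starProjection φ, h⟩ : π.domain) = φ :=
    Subtype.ext (Submodule.starProjection_eq_self_iff.mpr hφ)
  have := hc a
  rw [e] at this
  rw [this]
  exact Submodule.starProjection_apply_mem _ _

/-- A continuous surjection carries dense sets to dense sets, and the projection onto `K` sends
`D(π)` into `D(π) ∩ K`. -/
theorem dense_comap (hK : π.Reduces K) : Dense (π.domain.comap K.subtype : Set K) := by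
  have hs : Function.Surjective K.orthogonalProjectionOnto := fun x =>
    ⟨x, K.orthogonalProjectionOnto_mem_subspace_eq_self x⟩
  refine (hs.denseRange.dense_image K.orthogonalProjectionOnto.continuous π.dense).mono ?_
  rintro _ ⟨φ, hφ, rfl⟩
  exact (hK ⟨φ, hφ⟩).1

/-- The operator `π(a)` restricted to `D(π) ∩ K`. -/
def restrictOp (hK : π.Reduces K) (a : A) : Module.End ℂ (π.domain.comap K.subtype) where
  toFun x := ⟨⟨π.toHom a ⟨x.1, x.2⟩, hK.toHom_mem a ⟨x.1, x.2⟩ x.1.2⟩,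
    (π.toHom a ⟨x.1, x.2⟩).2⟩
  map_add' x y := by
    have h := congrArg (fun z : π.domain => (z : H))
      ((π.toHom a).map_add ⟨x.1, x.2⟩ ⟨y.1, y.2⟩)
    exact Subtype.ext (Subtype.ext h)
  map_smul' c x := by
    have h := congrArg (fun z : π.domain => (z : H)) ((π.toHom a).map_smul c ⟨x.1, x.2⟩)
    exact Subtype.ext (Subtype.ext h)

/-- The restriction of `π` to a reducing subspace. -/
def restrict (hK : π.Reduces K) : StarRep A K where
  domain := π.domain.comap K.subtype
  dense := hK.dense_comap
  toHom :=
    { toFun := hK.restrictOp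
      map_smul' := fun c a => by
        refine LinearMap.ext fun x => Subtype.ext <| Subtype.ext ?_
        simp [restrictOp]
      map_zero' := by
        refine LinearMap.ext fun x => Subtype.ext <| Subtype.ext ?_
        simp [restrictOp]
      map_add' := fun a b => by
        refine LinearMap.ext fun x => Subtype.ext <| Subtype.ext ?_
        simp [restrictOp]
      map_mul' := fun a b => by
        refine LinearMap.ext fun x => Subtype.ext <| Subtype.ext ?_
        simp [restrictOp] }
  adjoint_rel a φ ψ := π.adjoint_rel a ⟨φ.1, φ.2⟩ ⟨ψ.1, ψ.2⟩

theorem map_orthogonalDecomposition (hK : π.Reduces K) :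
    π.domain.map K.orthogonalDecomposition.toLinearEquiv.toLinearMap
      = (directSum hK.restrict hK.orthogonal.restrict).domain := by
  refine le_antisymm ?_ fun x hx => ?_
  · rintro _ ⟨φ, hφ, rfl⟩
    change K.orthogonalDecomposition φ ∈ _
    rw [K.orthogonalDecomposition_apply]
    exact ⟨(hK ⟨φ, hφ⟩).1, (hK.orthogonal ⟨φ, hφ⟩).1⟩
  · refine ⟨K.orthogonalDecomposition.symm x, ?_, K.orthogonalDecomposition.apply_symm_apply x⟩
    rw [K.orthogonalDecomposition_symm_apply]
    exact π.domain.add_mem hx.1 hx.2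

theorem unitarilyEquivalent (hK : π.Reduces K) :
    UnitarilyEquivalent π (directSum hK.restrict hK.orthogonal.restrict) := by
  refine ⟨⟨K.orthogonalDecomposition.toLinearEquiv.ofSubmodules _ _
    hK.map_orthogonalDecomposition, fun φ => K.orthogonalDecomposition.norm_map φ⟩,
    fun a φ => ?_⟩
  apply Subtype.ext
  change K.orthogonalDecomposition (π.toHom a φ : H) = _
  rw [K.orthogonalDecomposition_apply]
  apply (WithLp.equiv 2 _).injective
  refine Prod.ext (Subtype.ext ?_) (Subtype.ext ?_)
  · change K.starProjection (π.toHom a φ : H) = (π.toHom a _ : H)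
    rw [← (hK φ).2 a]
    congr 3
  · change Kᗮ.starProjection (π.toHom a φ : H) = (π.toHom a _ : H)
    rw [← (hK.orthogonal φ).2 a]
    congr 3
    exact congrArg (fun z => ((WithLp.snd z : Kᗮ) : H)) (K.orthogonalDecomposition_apply φ).symm

/-- The domain of the restriction is dense in `K`, while `{0}` is already closed. -/
theorem eq_bot_of_domain_eq_bot (hK : π.Reduces K) (h : hK.restrict.domain = ⊥) : K = ⊥ := by
  have hd := hK.restrict.dense
  rw [h, Submodule.bot_coe, dense_iff_closure_eq, closure_singleton] at hd
  refine (Submodule.eq_bot_iff K).mpr fun x hx => ?_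
  have : (⟨x, hx⟩ : K) ∈ ({0} : Set K) := hd ▸ Set.mem_univ _
  exact congrArg Subtype.val this

theorem eq_bot_or [CompleteSpace H] (hK : π.Reduces K) (hπ : π.Irreducible) (hc : CompleteSpace K) :
    K = ⊥ ∨ Kᗮ = ⊥ :=
  (hπ K Kᗮ _ _ hK.unitarilyEquivalent).imp hK.eq_bot_of_domain_eq_bot
    hK.orthogonal.eq_bot_of_domain_eq_bot

end Reduces

/-! ### Bounded operators acting on the closed graph -/

variable (π : StarRep A H)

/-- `T` preserves the completion of `D(π)` in the graph topology, that is, maps `D(π̄)` into itself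
and commutes with all `π̄(a)`. -/
def PreservesGraph (T : H →L[ℂ] H) : Prop :=
  ∀ z ∈ π.closedGraph, (T z.1, fun a => T (z.2 a)) ∈ π.closedGraph

variable {π}

theorem isClosed_closedGraph : IsClosed (π.closedGraph : Set (H × (A → H))) :=
  Submodule.isClosed_topologicalClosure _

theorem PreservesGraph.of_graphMap {T : H →L[ℂ] H}
    (h : ∀ φ, (T (π.graphMap φ).1, fun a => T ((π.graphMap φ).2 a)) ∈ π.closedGraph) :
    π.PreservesGraph T := fun _ hz =>
  π.closedGraph_induction (P := fun z => (T z.1, fun a => T (z.2 a)) ∈ π.closedGraph)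
    (isClosed_closedGraph.preimage (by fun_prop)) h hz

/-- The graph topology is a product topology on `H × (A → H)`, so pointwise convergence is enough.
The approximants are bare functions because Birkhoff averages come in that form. -/
theorem PreservesGraph.of_tendsto {T : H →L[ℂ] H} {F : ℕ → H → H}
    (hF : ∀ x, Filter.Tendsto (fun n => F n x) Filter.atTop (nhds (T x)))
    (h : ∀ n, ∀ z ∈ π.closedGraph, (F n z.1, fun a => F n (z.2 a)) ∈ π.closedGraph) :
    π.PreservesGraph T := fun z hz =>
  isClosed_closedGraph.mem_of_tendsto
    ((hF z.1).prodMk_nhds (tendsto_pi_nhds.mpr fun a => hF (z.2 a)))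
    (Filter.Eventually.of_forall fun n => h n z hz)

/-- Each `z` in the closed graph imposes a closed condition on `T`, since evaluation at a vector is
norm continuous. This lets the continuous functional calculus stay inside the commutant. -/
theorem isClosed_preservesGraph : IsClosed {T : H →L[ℂ] H | π.PreservesGraph T} := by
  simp only [PreservesGraph, Set.ofPred_forall]
  refine isClosed_iInter fun z => isClosed_iInter fun _ => isClosed_closedGraph.preimage ?_
  fun_prop

theorem PreservesGraph.mul {S T : H →L[ℂ] H} (hS : π.PreservesGraph S)
    (hT : π.PreservesGraph T) : π.PreservesGraph (S * T) := fun z hz => hS _ (hT z hz)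

theorem PreservesGraph.add {S T : H →L[ℂ] H} (hS : π.PreservesGraph S)
    (hT : π.PreservesGraph T) : π.PreservesGraph (S + T) := fun z hz =>
  π.closedGraph.add_mem (hS z hz) (hT z hz)

theorem preservesGraph_algebraMap (c : ℂ) : π.PreservesGraph (algebraMap ℂ (H →L[ℂ] H) c) :=
  fun _ hz => π.closedGraph.smul_mem c hz

/-- Translates invariance of the closed graph into the form required by `Reduces`. -/
theorem PreservesGraph.closure_apply {T : H →L[ℂ] H} (hT : π.PreservesGraph T)
    (φ : π.closure.domain) : ∃ h : T φ ∈ π.closure.domain,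
      ∀ a, (π.closure.toHom a ⟨T φ, h⟩ : H) = T (π.closure.toHom a φ) := by
  obtain ⟨z, rfl⟩ := π.closureEquiv.surjective φ
  have hz := hT z.1 z.2
  refine ⟨⟨⟨_, hz⟩, rfl⟩, fun a => ?_⟩
  have e1 := π.closureOp_apply a ⟨_, hz⟩
  have e2 := π.closureOp_apply a z
  change (π.closureOp a (π.closureEquiv ⟨_, hz⟩) : H) = T (π.closureOp a (π.closureEquiv z) : H)
  rw [e1, e2]

variable [CompleteSpace H]

variable (π) in
/-- The operators which together with their adjoints preserve the closed graph. -/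
def graphCommutant : StarSubalgebra ℂ (H →L[ℂ] H) where
  carrier := {T | π.PreservesGraph T ∧ π.PreservesGraph (star T)}
  mul_mem' hS hT := ⟨hS.1.mul hT.1, by rw [star_mul]; exact hT.2.mul hS.2⟩
  add_mem' hS hT := ⟨hS.1.add hT.1, by rw [star_add]; exact hS.2.add hT.2⟩
  algebraMap_mem' c := ⟨preservesGraph_algebraMap c, by
    rw [← algebraMap_star_comm]; exact preservesGraph_algebraMap _⟩
  star_mem' hT := ⟨hT.2, by rw [star_star]; exact hT.1⟩

theorem isClosed_graphCommutant : IsClosed (π.graphCommutant : Set (H →L[ℂ] H)) :=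
  isClosed_preservesGraph.inter (isClosed_preservesGraph.preimage continuous_star)

theorem PreservesGraph.iterate {T : H →L[ℂ] H} (hT : π.PreservesGraph T) (n : ℕ)
    {z : H × (A → H)} (hz : z ∈ π.closedGraph) :
    (T^[n] z.1, fun a => T^[n] (z.2 a)) ∈ π.closedGraph := by
  induction n with
  | zero => exact hz
  | succ n ih =>
    simp only [Function.iterate_succ_apply']
    exact hT _ ih

theorem PreservesGraph.birkhoffAverage {T : H →L[ℂ] H} (hT : π.PreservesGraph T) (n : ℕ)
    {z : H × (A → H)} (hz : z ∈ π.closedGraph) :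
    (birkhoffAverage ℂ T _root_.id n z.1, fun a => birkhoffAverage ℂ T _root_.id n (z.2 a))
      ∈ π.closedGraph := by
  have h := π.closedGraph.smul_mem ((n : ℂ)⁻¹)
    (sum_mem fun k (_ : k ∈ Finset.range n) => hT.iterate k hz)
  convert h using 1
  refine Prod.ext ?_ (funext fun a => ?_)
  · simp [_root_.birkhoffAverage, birkhoffSum, Prod.fst_sum]
  · simp [_root_.birkhoffAverage, birkhoffSum, Prod.snd_sum, Finset.sum_apply]

/-- The fixed space of a contraction preserving the closed graph reduces the closure. -/
theorem PreservesGraph.reduces_eqLocus {T : H →L[ℂ] H} (hT : π.PreservesGraph T)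
    (h1 : ‖T‖ ≤ 1) : π.closure.Reduces (T.eqLocus (1 : H →L[ℂ] H)) := by
  have h : π.PreservesGraph (T.eqLocus (1 : H →L[ℂ] H)).starProjection :=
    -- Von Neumann's mean ergodic theorem: the Birkhoff averages of a contraction converge strongly
    -- to the orthogonal projection onto its fixed space.
    PreservesGraph.of_tendsto (F := fun n x => _root_.birkhoffAverage ℂ T _root_.id n x)
      (fun x => T.tendsto_birkhoffAverage_orthogonalProjection h1 x)
      (fun n z hz => hT.birkhoffAverage n hz)
  exact h.closure_apply

/-! ### Nonscalar normal operators in the commutant -/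

/-- On a one-point spectrum `{l}` the identity function agrees with the constant `l`, so the
functional calculus would make `U` a scalar. -/
theorem _root_.IsStarNormal.exists_ne_mem_spectrum {U : H →L[ℂ] H} (hU : IsStarNormal U)
    (hs : ∀ c : ℂ, U ≠ algebraMap ℂ _ c) :
    ∃ l ∈ spectrum ℂ U, ∃ m ∈ spectrum ℂ U, l ≠ m := by
  have : Nontrivial (H →L[ℂ] H) := ⟨U, _, hs 0⟩
  obtain ⟨l, hl⟩ := spectrum.nonempty U
  by_contra! h
  refine hs l ?_
  conv_lhs => rw [← cfc_id ℂ U]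
  rw [← cfc_const l U]
  exact cfc_congr fun m hm => (h l hl m hm).symm

/-- Schur's lemma: an irreducible closure has no nonscalar normal operator in its commutant. -/
theorem not_irreducible_closure {U : H →L[ℂ] H} (hU : IsStarNormal U) (hs : ∀ c : ℂ, U ≠ algebraMap ℂ _ c)
    (hm : U ∈ π.graphCommutant) : ¬ π.closure.Irreducible := by
  intro hirr
  obtain ⟨l, hl, m, hmu, hlm⟩ := hU.exists_ne_mem_spectrum hs
  set r : ℝ := ‖m - l‖ / 2 with hr
  have hd : 0 < ‖m - l‖ := norm_pos_iff.mpr (sub_ne_zero.mpr hlm.symm)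
  have hr0 : 0 < r := by positivity
  -- `s` vanishes at `l` and is `1` at distance at least `r` from `l`; `g` is a bump with `g m = 1`
  -- that vanishes at distance at least `r` from `m`. As `‖m - l‖ = 2r`, `s = 1` wherever `g ≠ 0`.
  let s : ℂ → ℂ := fun z => ((min 1 (‖z - l‖ / r) : ℝ) : ℂ)
  let g : ℂ → ℂ := fun z => ((max 0 (1 - ‖z - m‖ / r) : ℝ) : ℂ)
  have hsc : Continuous s := by fun_prop
  have hgc : Continuous g := by fun_prop
  have hsg : ∀ z, s z * g z = g z := by
    intro z
    rcases le_total r ‖z - l‖ with h | h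
    · have : min 1 (‖z - l‖ / r) = 1 := min_eq_left ((one_le_div hr0).mpr h)
      simp [s, this]
    · have h2 : r ≤ ‖z - m‖ := by
        have := norm_sub_le (z - l) (z - m)
        rw [sub_sub_sub_cancel_left] at this
        linarith
      have : max 0 (1 - ‖z - m‖ / r) = 0 :=
        max_eq_left (by linarith [(one_le_div hr0).mpr h2])
      simp [g, this]
  have hSG : cfc s U * cfc g U = cfc g U := by
    rw [← cfc_mul s g U hsc.continuousOn hgc.continuousOn]
    exact cfc_congr fun z _ => hsg z
  have hS1 : ‖cfc s U‖ ≤ 1 := by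
    refine norm_cfc_le zero_le_one fun z _ => ?_
    have h0 : 0 ≤ min 1 (‖z - l‖ / r) := by positivity
    rw [Complex.norm_real, Real.norm_of_nonneg h0]
    exact min_le_left _ _
  -- The functional calculus takes values in the closed star subalgebra generated by `U`, which the
  -- closed commutant contains.
  have hSm : cfc s U ∈ π.graphCommutant :=
    StarAlgebra.elemental.le_of_mem isClosed_graphCommutant hm (cfc_mem_elemental s U)
  have hred := hSm.1.reduces_eqLocus hS1
  rcases hred.eq_bot_or hirr inferInstance with h | h
  -- By `hSG` the range of `g(U)` is fixed by `s(U)`; if the fixed space is zero then `g = 0` on the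
  -- spectrum, against `g m = 1`.
  · have hG : cfc g U = cfc (fun _ => (0 : ℂ)) U := by
      rw [cfc_const_zero]
      ext x
      have hx : cfc g U x ∈ (cfc s U).eqLocus (1 : H →L[ℂ] H) := congrArg (fun T : H →L[ℂ] H => T x) hSG
      rw [h] at hx
      exact hx
    have := (cfc_eq_cfc_iff_eqOn (R := ℂ) (a := U) hU hgc.continuousOn continuousOn_const).mp hG hmu
    simp [g] at this
  -- If everything is fixed then `s = 1` on the spectrum, against `s l = 0`.
  · have hS : cfc s U = cfc (fun _ => (1 : ℂ)) U := by
      rw [cfc_const_one ℂ U]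
      ext x
      have hx : x ∈ (cfc s U).eqLocus (1 : H →L[ℂ] H) := by
        rw [(Submodule.orthogonal_eq_bot_iff).mp h]; trivial
      exact hx
    have := (cfc_eq_cfc_iff_eqOn (R := ℂ) (a := U) hU hsc.continuousOn continuousOn_const).mp hS hl
    simp [s] at this

end StarRep

/-! ### Extension of contractions to the completion -/

/-- The extension of a contraction of a semi-inner product space to the completion. -/
def completionOfNormLe {E : Type*} [SeminormedAddCommGroup E] [InnerProductSpace ℂ E]
    (f : E →ₗ[ℂ] E) (hf : ∀ x, ‖f x‖ ≤ ‖x‖) :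
    UniformSpace.Completion E →L[ℂ] UniformSpace.Completion E :=
  (f.mkContinuous 1 fun x => by rw [one_mul]; exact hf x).completion

theorem completionOfNormLe_coe {E : Type*} [SeminormedAddCommGroup E] [InnerProductSpace ℂ E]
    (f : E →ₗ[ℂ] E) (hf : ∀ x, ‖f x‖ ≤ ‖x‖) (x : E) :
    completionOfNormLe f hf x = (f x : UniformSpace.Completion E) :=
  ContinuousLinearMap.completion_apply_coe _ _

section Graded

open StarGrading

variable {A : Type u} [Ring A] [StarRing A] [Algebra ℂ A] [StarModule ℂ A]
variable {G : Type v} [Group G] [DecidableEq G]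
variable {𝒜 : G → Submodule ℂ A} [StarGrading 𝒜]

/-! ### The projection onto the identity component -/

theorem canonicalProjection_coe (b : base 𝒜) : (canonicalProjection 𝒜).toLin (b : A) = b :=
  Subtype.ext (component_self 𝒜 b.2)

theorem canonicalProjection_of_ne {g : G} (hg : g ≠ 1) {a : A} (ha : a ∈ 𝒜 g) :
    (canonicalProjection 𝒜).toLin a = 0 :=
  Subtype.ext (congrArg Subtype.val (component_ne 𝒜 hg ha))

/-- Passing from `y` to `a* y a` conjugates degrees by `g`, and only the identity degree is
conjugate to the identity. -/
theorem canonicalProjection_sandwich {g : G} (a : 𝒜 g) (y : A) :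
    (canonicalProjection 𝒜).toLin (star (a : A) * y * a)
      = sandwich a ((canonicalProjection 𝒜).toLin y) := by
  refine homogeneous_induction 𝒜 (P := fun y => (canonicalProjection 𝒜).toLin (star (a : A) * y * a)
      = sandwich a ((canonicalProjection 𝒜).toLin y)) y (fun k y hy => ?_) ?_ (fun x y hx hy => ?_)
  · by_cases hk : k = 1
    · subst hk
      rw [canonicalProjection_coe ⟨y, hy⟩]
      exact canonicalProjection_coe (sandwich a ⟨y, hy⟩)
    · rw [canonicalProjection_of_ne hk hy,
        canonicalProjection_of_ne _ (mul_mem (mul_mem (star_mem a.2) hy) a.2)]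
      · apply Subtype.ext; simp [sandwich]
      · intro h
        rw [mul_assoc, inv_mul_eq_one, eq_comm, mul_eq_right] at h
        exact hk h
  · rw [mul_zero, zero_mul, map_zero]
    apply Subtype.ext; simp [sandwich]
  · rw [mul_add, add_mul, map_add, hx, hy, map_add]
    apply Subtype.ext; simp [sandwich, mul_add, add_mul]

namespace PosCharacter

variable [IsMulCommutative (base 𝒜)] (χ : PosCharacter 𝒜)

/-! ### The vectors `[x]` of the induced representation -/

/-- `x ↦ [x ⊗ 1]`. -/
def vec : A →ₗ[ℂ] IndSpace χ.inducible :=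
  indMk χ.inducible ∘ₗ
    ((TensorProduct.mk ℂ A (charRep χ.toChar).domain).flip ⟨1, trivial⟩ :
      A →ₗ[ℂ] A ⊗[ℂ] (charRep χ.toChar).domain)

theorem tmul_eq (x : A) (t : (charRep χ.toChar).domain) :
    x ⊗ₜ[ℂ] t = ((t : ℂ) • x) ⊗ₜ[ℂ] (⟨1, trivial⟩ : (charRep χ.toChar).domain) := by
  rw [TensorProduct.smul_tmul]
  congr 1
  exact Subtype.ext (mul_one (t : ℂ)).symm

/-- The representation space of a character is a line, so every tensor is elementary. Thus the
vectors `[x]` exhaust the domain of `π₀`. -/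
theorem eq_charMul_tmul (η : A ⊗[ℂ] (charRep χ.toChar).domain) :
    η = charMul χ.toChar η ⊗ₜ[ℂ] (⟨1, trivial⟩ : (charRep χ.toChar).domain) := by
  induction η with
  | zero => simp
  | add η η' h h' => rw [map_add, TensorProduct.add_tmul, ← h, ← h']
  | tmul x t => exact χ.tmul_eq x t

theorem indMk_eq_vec (η : IndPre (canonicalProjection 𝒜) (charRep χ.toChar) χ.inducible) :
    indMk χ.inducible η = χ.vec (charMul χ.toChar η) :=
  congrArg (indMk χ.inducible) (χ.eq_charMul_tmul η)

theorem charMul_tmul_one (x : A) :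
    charMul χ.toChar (x ⊗ₜ[ℂ] (⟨1, trivial⟩ : (charRep χ.toChar).domain)) = x :=
  one_smul ℂ x

theorem vec_inner (x y : A) :
    inner ℂ (χ.vec x) (χ.vec y) = χ.toChar ((canonicalProjection 𝒜).toLin (star x * y)) := by
  refine (indMk_inner χ.inducible _ _).trans ((inductionForm_charRep χ.toChar _ _).trans ?_)
  change χ.toChar ((canonicalProjection 𝒜).toLin (star (charMul χ.toChar (x ⊗ₜ[ℂ] _))
    * charMul χ.toChar (y ⊗ₜ[ℂ] _))) = _
  rw [charMul_tmul_one, charMul_tmul_one]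

theorem denseRange_vec : DenseRange χ.vec := by
  have hd : DenseRange (indMk χ.inducible) := UniformSpace.Completion.denseRange_coe
  refine hd.mono ?_
  rintro _ ⟨η, rfl⟩
  exact ⟨_, (χ.indMk_eq_vec η).symm⟩

theorem vec_one_inner_self : inner ℂ (χ.vec 1) (χ.vec 1) = (1 : ℂ) := by
  rw [vec_inner, star_one, one_mul]
  have := (canonicalProjection 𝒜).map_one
  rw [this, map_one]

/-- With `c = b - χ(b)`, the squared norm of `[xc]` is `χ(c* p(x*x) c)`, which vanishes because
`χ(c) = 0`. -/
theorem vec_mul_base (x : A) (b : base 𝒜) : χ.vec (x * b) = χ.toChar b • χ.vec x := by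
  rw [← map_smul, ← sub_eq_zero, ← map_sub, ← inner_self_eq_zero (𝕜 := ℂ), vec_inner]
  have e : x * b - χ.toChar b • x = x * (b - algebraMap ℂ (base 𝒜) (χ.toChar b) : base 𝒜) := by
    change _ = x * (b - algebraMap ℂ A (χ.toChar b))
    rw [mul_sub, Algebra.algebraMap_eq_smul_one, mul_smul_comm, mul_one]
  set c := b - algebraMap ℂ (base 𝒜) (χ.toChar b) with hc
  have hc0 : χ.toChar c = 0 := by rw [hc, map_sub, AlgHomClass.commutes]; exact sub_self _
  have e2 : star (x * (c : A)) * (x * c) = ((star c : base 𝒜) : A) * (star x * x) * c := by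
    simp [mul_assoc]
  rw [e, e2, (canonicalProjection 𝒜).map_mul, map_mul, hc0, mul_zero]

/-- With `d = b - χ^g(b)`, the squared norm of `[dc]` is `χ(c* d*d c) = χ(c*c) χ^g(d*d)`, which is
zero because `χ^g` is multiplicative. -/
theorem vec_base_mul {g : G} (c : 𝒜 g) (hc : χ.toChar (gradedInner c c) ≠ 0) (b : base 𝒜) :
    χ.vec (b * c) = (χ.actBy c hc).toChar b • χ.vec (c : A) := by
  rw [← map_smul, ← sub_eq_zero, ← map_sub, ← inner_self_eq_zero (𝕜 := ℂ), vec_inner]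
  set t := (χ.actBy c hc).toChar b with ht
  set d := b - algebraMap ℂ (base 𝒜) t with hd
  have e : (b : A) * c - t • (c : A) = (d : A) * c := by
    change _ = ((b : A) - algebraMap ℂ A t) * c
    rw [sub_mul, Algebra.algebraMap_eq_smul_one, smul_mul_assoc, one_mul]
  have hd0 : (χ.actBy c hc).toChar d = 0 := by
    rw [hd, map_sub, AlgHomClass.commutes]; exact sub_self _
  have e2 : star ((d : A) * c) * (d * c) = sandwich c (star d * d) := by
    simp [sandwich, mul_assoc]
  rw [e, e2, canonicalProjection_coe]
  have h : (χ.actBy c hc).toChar (star d * d) = 0 := by rw [map_mul, hd0, mul_zero]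
  rw [actBy_apply, div_eq_zero_iff] at h
  exact h.resolve_right hc

theorem ind₀_apply (a x : A) :
    (indRep₀ χ.inducible).toHom a ⟨χ.vec x, _, rfl⟩ = ⟨χ.vec (a * x), _, rfl⟩ :=
  indOp_apply χ.inducible a _

theorem vec_mem (x : A) : χ.vec x ∈ χ.ind.domain :=
  ⟨⟨_, (indRep₀ χ.inducible).graphMap_mem ⟨χ.vec x, _, rfl⟩⟩, rfl⟩

theorem ind_apply (a x : A) :
    χ.ind.toHom a ⟨χ.vec x, χ.vec_mem x⟩ = ⟨χ.vec (a * x), χ.vec_mem _⟩ := by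
  apply Subtype.ext
  exact ((indRep₀ χ.inducible).closureOp_apply a
    ⟨_, (indRep₀ χ.inducible).graphMap_mem ⟨χ.vec x, _, rfl⟩⟩).trans
    (congrArg Subtype.val (χ.ind₀_apply a x))

/-! ### Right multiplication by elements which fix the character -/

/-- `χ(a* b a) = χ(b)` for all `b ∈ B`. -/
def Fixes {g : G} (a : 𝒜 g) : Prop := ∀ b, χ.toChar (sandwich a b) = χ.toChar b

variable {χ}

theorem exists_fixes {g : G} (hg : g ∈ χ.stabilizer) : ∃ a : 𝒜 g, χ.Fixes a := by
  obtain ⟨a, ha, hb⟩ := (χ.exists_act_eq_iff g).mp hg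
  obtain ⟨r, hr0, hr⟩ : ∃ r : ℝ, 0 ≤ r ∧ χ.toChar (gradedInner a a) = r := by
    have h := χ.gradedInner_nonneg a
    exact ⟨_, (Complex.nonneg_iff.mp h).1, Complex.eq_re_of_ofReal_le h⟩
  have hrne : r ≠ 0 := fun h => ha (by rw [hr, h, Complex.ofReal_zero])
  -- Normalizing by `√χ(a*a)` turns `χ(a*ba) = χ(b) χ(a*a)` into exact invariance.
  refine ⟨((√r)⁻¹ : ℂ) • a, fun b => ?_⟩
  have e : sandwich (((√r)⁻¹ : ℂ) • a) b = ((r : ℂ)⁻¹) • sandwich a b := by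
    have h2 : ((√r : ℝ) : ℂ)⁻¹ * ((√r : ℝ) : ℂ)⁻¹ = (r : ℂ)⁻¹ := by
      rw [← mul_inv, ← Complex.ofReal_mul, Real.mul_self_sqrt hr0]
    apply Subtype.ext
    simp [sandwich, smul_smul, h2]
  rw [e, map_smul, hb, hr, smul_eq_mul]
  field_simp

namespace Fixes

variable {g : G} {a : 𝒜 g}

theorem gradedInner_self (ha : χ.Fixes a) : χ.toChar (gradedInner a a) = 1 := by
  have h := ha 1
  rw [map_one] at h
  rw [← h]
  congr 1
  apply Subtype.ext; simp [sandwich, gradedInner]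

/-- Invariance under `a`, applied to `a b a*`, gives `χ(aba*) = χ(a*a b a*a)`, and `χ(a*a) = 1`. -/
theorem adjoint (ha : χ.Fixes a) : χ.Fixes (⟨star (a : A), star_mem a.2⟩ : 𝒜 g⁻¹) := fun b => by
  have e : sandwich a (sandwich (𝒜 := 𝒜) (g := g⁻¹) ⟨star (a : A), star_mem a.2⟩ b)
      = gradedInner a a * b * gradedInner a a := by
    apply Subtype.ext; simp [sandwich, gradedInner, mul_assoc]
  rw [← ha, e, map_mul, map_mul, ha.gradedInner_self, one_mul, mul_one]

theorem vec_inner_mul (ha : χ.Fixes a) (x y : A) :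
    inner ℂ (χ.vec (x * a)) (χ.vec (y * a)) = inner ℂ (χ.vec x) (χ.vec y) := by
  rw [vec_inner, vec_inner, ← ha ((canonicalProjection 𝒜).toLin (star x * y)),
    ← canonicalProjection_sandwich]
  simp only [star_mul, mul_assoc]

/-- The isometry property on all of `A ⊗ ℂ`, needed to extend right multiplication to the
completion. -/
theorem norm_indMk_mulRight (ha : χ.Fixes a)
    (η : IndPre (canonicalProjection 𝒜) (charRep χ.toChar) χ.inducible) :
    ‖indMk χ.inducible ((LinearMap.mulRight ℂ (a : A)).rTensor (charRep χ.toChar).domain η)‖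
      = ‖indMk χ.inducible η‖ := by
  have e : (LinearMap.mulRight ℂ (a : A)).rTensor (charRep χ.toChar).domain η
      = (charMul χ.toChar η * a) ⊗ₜ[ℂ] (⟨1, trivial⟩ : (charRep χ.toChar).domain) := by
    conv_lhs => rw [χ.eq_charMul_tmul η]
    rfl
  rw [e, indMk_eq_vec χ η]
  change ‖χ.vec (charMul χ.toChar η * a)‖ = _
  rw [@norm_eq_sqrt_re_inner ℂ, @norm_eq_sqrt_re_inner ℂ, ha.vec_inner_mul]

/-- The operator `[x] ↦ [xa]` on the Hilbert space of `Ind χ`. -/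
def rightMul (ha : χ.Fixes a) : IndSpace χ.inducible →L[ℂ] IndSpace χ.inducible :=
  completionOfNormLe (E := IndPre (canonicalProjection 𝒜) (charRep χ.toChar) χ.inducible)
    ((LinearMap.mulRight ℂ (a : A)).rTensor (charRep χ.toChar).domain) fun η =>
      ((UniformSpace.Completion.norm_coe _).symm.trans
        ((ha.norm_indMk_mulRight η).trans (UniformSpace.Completion.norm_coe _))).le

theorem rightMul_vec (ha : χ.Fixes a) (x : A) : ha.rightMul (χ.vec x) = χ.vec (x * a) :=
  completionOfNormLe_coe _ _ _

theorem norm_rightMul (ha : χ.Fixes a) (z : IndSpace χ.inducible) : ‖ha.rightMul z‖ = ‖z‖ := by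
  refine χ.denseRange_vec.induction_on z (isClosed_eq (by fun_prop) (by fun_prop)) fun x => ?_
  rw [rightMul_vec, @norm_eq_sqrt_re_inner ℂ, @norm_eq_sqrt_re_inner ℂ, ha.vec_inner_mul]

theorem rightMul_mul_rightMul_star (ha : χ.Fixes a) : ha.rightMul * ha.adjoint.rightMul = 1 := by
  refine ContinuousLinearMap.ext fun z => ?_
  refine χ.denseRange_vec.induction_on z (isClosed_eq (by fun_prop) (by fun_prop)) fun x => ?_
  rw [mul_apply_eq_comp, rightMul_vec, rightMul_vec, mul_assoc]
  -- The composite multiplies on the right by `a*a ∈ B`, which acts as the scalar `χ(a*a) = 1`.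
  change χ.vec (x * (gradedInner a a : base 𝒜)) = χ.vec x
  rw [vec_mul_base, ha.gradedInner_self, one_smul]

theorem star_mul_rightMul (ha : χ.Fixes a) : star ha.rightMul * ha.rightMul = 1 :=
  ha.rightMul.norm_map_iff_adjoint_comp_self.mp ha.norm_rightMul

/-- For an isometry `U` with right inverse `V`, `U* = U*UV = V`. -/
theorem star_rightMul (ha : χ.Fixes a) : star ha.rightMul = ha.adjoint.rightMul := by
  rw [← mul_one (star ha.rightMul), ← ha.rightMul_mul_rightMul_star, ← mul_assoc,
    ha.star_mul_rightMul, one_mul]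

theorem isStarNormal_rightMul (ha : χ.Fixes a) : IsStarNormal ha.rightMul := by
  refine ⟨?_⟩
  rw [commute_iff_eq, ha.star_mul_rightMul, ha.star_rightMul, ha.rightMul_mul_rightMul_star]

/-- Associativity: right multiplication commutes with the left action on the vectors `[x]`, and this
passes to the closed graph. -/
theorem preservesGraph_rightMul (ha : χ.Fixes a) :
    (indRep₀ χ.inducible).PreservesGraph ha.rightMul := by
  refine StarRep.PreservesGraph.of_graphMap fun φ => ?_
  obtain ⟨x, rfl⟩ : ∃ x, φ = ⟨χ.vec x, _, rfl⟩ := by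
    obtain ⟨_, η, rfl⟩ := φ
    exact ⟨_, Subtype.ext (χ.indMk_eq_vec η)⟩
  convert (indRep₀ χ.inducible).graphMap_mem ⟨χ.vec (x * a), _, rfl⟩ using 1
  refine Prod.ext (ha.rightMul_vec x) (funext fun b => ?_)
  have e1 := congrArg Subtype.val (χ.ind₀_apply b x)
  have e2 := congrArg Subtype.val (χ.ind₀_apply b (x * a))
  refine (congrArg ha.rightMul e1).trans (Eq.trans ?_ e2.symm)
  rw [← mul_assoc]
  exact ha.rightMul_vec (b * x)

theorem rightMul_mem_graphCommutant (ha : χ.Fixes a) :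
    ha.rightMul ∈ (indRep₀ χ.inducible).graphCommutant :=
  ⟨ha.preservesGraph_rightMul, ha.star_rightMul ▸ ha.adjoint.preservesGraph_rightMul⟩

/-- A scalar would give `[a] = c[1]`; orthogonality of distinct degrees forces `c = 0`,
contradicting that the operator is isometric. -/
theorem rightMul_ne_algebraMap (ha : χ.Fixes a) (hg : g ≠ 1) (c : ℂ) :
    ha.rightMul ≠ algebraMap ℂ _ c := by
  intro h
  have h1 : χ.vec (a : A) = c • χ.vec 1 := by
    rw [← one_mul (a : A), ← ha.rightMul_vec, h]; rfl
  have h2 : inner ℂ (χ.vec 1) (χ.vec (a : A)) = (0 : ℂ) := by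
    rw [vec_inner, star_one, one_mul, canonicalProjection_of_ne hg a.2, map_zero]
  rw [h1, inner_smul_right, vec_one_inner_self, mul_one] at h2
  have h3 := ha.norm_rightMul (χ.vec 1)
  rw [ha.rightMul_vec, one_mul, h1, h2, zero_smul, norm_zero, eq_comm, norm_eq_zero] at h3
  have h4 := χ.vec_one_inner_self
  rw [h3, inner_zero_left] at h4
  exact zero_ne_one h4

end Fixes

theorem stabilizer_eq_bot_of_irreducible (h : χ.ind.Irreducible) : χ.stabilizer = ⊥ := by
  refine (Subgroup.eq_bot_iff_forall _).mpr fun g hg => ?_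
  by_contra hne
  obtain ⟨a, ha⟩ := exists_fixes hg
  exact StarRep.not_irreducible_closure ha.isStarNormal_rightMul (ha.rightMul_ne_algebraMap hne)
    ha.rightMul_mem_graphCommutant h

/-! ### Irreducibility -/

/-- If the stabilizer is trivial, then the weight space of `Ind χ` for `χ` is spanned by `[1]`. -/
theorem eq_smul_vec_one (hst : χ.stabilizer = ⊥) (v : χ.ind.domain)
    (hv : ∀ b : base 𝒜, χ.ind.toHom (b : A) v = χ.toChar b • v) :
    ∃ c : ℂ, (v : IndSpace χ.inducible) = c • χ.vec 1 := by
  -- The coefficient of the orthogonal projection onto the unit vector `[1]`; the remainder is then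
  -- tested against homogeneous vectors.
  refine ⟨inner ℂ (χ.vec 1) (v : IndSpace χ.inducible), ?_⟩
  rw [← sub_eq_zero]
  refine χ.denseRange_vec.eq_zero_of_inner_left ℂ ?_
  intro x
  refine homogeneous_induction 𝒜 (P := fun x => inner ℂ _ (χ.vec x) = (0 : ℂ)) x (fun g x hx => ?_)
    (by simp) (fun x y hx hy => by rw [map_add, inner_add_right, hx, hy, add_zero])
  by_cases hg : g = 1
  · subst hg
    have e : χ.vec x = χ.toChar ⟨x, hx⟩ • χ.vec 1 := by
      rw [← vec_mul_base, one_mul]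
    rw [e, inner_smul_right, inner_sub_left, inner_smul_left, vec_one_inner_self, mul_one,
      inner_conj_symm, sub_self, mul_zero]
  · have h1 : inner ℂ (χ.vec 1) (χ.vec x) = (0 : ℂ) := by
      rw [vec_inner, star_one, one_mul, canonicalProjection_of_ne hg hx, map_zero]
    rw [inner_sub_left, inner_smul_left, h1, mul_zero, sub_zero]
    by_contra hne
    have hc : χ.toChar (gradedInner (⟨x, hx⟩ : 𝒜 g) ⟨x, hx⟩) ≠ 0 := by
      intro h0
      have : inner ℂ (χ.vec x) (χ.vec x) = (0 : ℂ) := by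
        rw [vec_inner, ← h0]
        exact congrArg _ (canonicalProjection_coe (gradedInner (⟨x, hx⟩ : 𝒜 g) ⟨x, hx⟩))
      rw [inner_self_eq_zero.mp this, inner_zero_right] at hne
      exact hne rfl
    refine hg ((Subgroup.eq_bot_iff_forall _).mp hst g ⟨⟨_, hc⟩, (act_eq_actBy _ _ _ _ hc).trans ?_⟩)
    refine PosCharacter.ext' fun b => ?_
    -- Moving `b` across the inner product compares weights: `χ(b)⟨v, [x]⟩ = χ^g(b)⟨v, [x]⟩`. A
    -- nonzero inner product would therefore put `g ≠ 1` in the stabilizer.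
    have h := χ.ind.adjoint_rel ((star b : base 𝒜) : A) v ⟨χ.vec x, χ.vec_mem x⟩
    rw [hv, ind_apply] at h
    have e : star ((star b : base 𝒜) : A) = (b : A) := star_star _
    simp only [e] at h
    rw [χ.vec_base_mul ⟨x, hx⟩ hc b, inner_smul_right, Submodule.coe_smul, inner_smul_left,
      map_star, starRingEnd_apply, star_star] at h
    exact (mul_right_cancel₀ hne h).symm

theorem irreducible_of_stabilizer_eq_bot (hst : χ.stabilizer = ⊥) : χ.ind.Irreducible := by
  intro K₁ K₂ _ _ _ _ _ _ π₁ π₂ ⟨U, hU⟩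
  set e : χ.ind.domain := ⟨χ.vec 1, χ.vec_mem 1⟩ with he
  have heb : ∀ b : base 𝒜, χ.ind.toHom (b : A) e = χ.toChar b • e := fun b => by
    rw [he, ind_apply]
    apply Subtype.ext
    change χ.vec ((b : A) * 1) = χ.toChar b • χ.vec 1
    rw [← vec_mul_base, mul_one, one_mul]
  have hcyc : ∀ a, χ.ind.toHom a e = ⟨χ.vec a, χ.vec_mem a⟩ := fun a => by
    rw [he, ind_apply]; simp only [mul_one]
  -- The projection onto the first summand; it commutes with the direct sum representation.
  let q : (StarRep.directSum π₁ π₂).domain →ₗ[ℂ] (StarRep.directSum π₁ π₂).domain :=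
    StarRep.sumOp 1 0
  have hq : ∀ a w, q ((StarRep.directSum π₁ π₂).toHom a w)
      = (StarRep.directSum π₁ π₂).toHom a (q w) := fun a w => by
    apply Subtype.ext
    apply (WithLp.equiv 2 (K₁ × K₂)).injective
    refine Prod.ext rfl ?_
    exact (congrArg Subtype.val (map_zero (π₂.toHom a))).symm
  have hUs : ∀ a w, U.symm ((StarRep.directSum π₁ π₂).toHom a w) = χ.ind.toHom a (U.symm w) :=
    fun a w => by rw [U.symm_apply_eq, hU, U.apply_symm_apply]
  -- Transported back by `U`, the projection of the cyclic vector `e` is again a weight vector for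
  -- `χ`, hence a multiple of `e`.
  obtain ⟨c, hc⟩ := eq_smul_vec_one hst (U.symm (q (U e))) fun b => by
    rw [← hUs, ← hq, ← hU, heb, map_smul, map_smul, map_smul]
  have hqe : q (U e) = c • U e := by
    rw [← map_smul, ← U.symm_apply_eq]
    exact Subtype.ext hc
  have hqa : ∀ a, q (U ⟨χ.vec a, χ.vec_mem a⟩) = c • U ⟨χ.vec a, χ.vec_mem a⟩ := fun a => by
    rw [← hcyc, hU, hq, hqe, map_smul]
  -- Density in the Hilbert norm suffices, even though the domain is complete for a finer topology,
  -- because `q` is norm continuous.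
  have hdense : DenseRange fun a : A => (⟨χ.vec a, χ.vec_mem a⟩ : χ.ind.domain) := by
    rw [DenseRange, Topology.IsInducing.subtypeVal.dense_iff]
    intro x
    rw [← Set.range_comp]
    exact χ.denseRange_vec x
  have hqc : Continuous q := by
    refine Continuous.subtype_mk ?_ _
    have h : Continuous fun w : (StarRep.directSum π₁ π₂).domain =>
        ((w : WithLp 2 (K₁ × K₂)).fst, (0 : K₂)) := by fun_prop
    exact (WithLp.prod_continuous_toLp 2 K₁ K₂).comp h
  have hqw : ∀ w, q w = c • w := by
    intro w
    rw [← U.apply_symm_apply w]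
    exact hdense.induction_on (U.symm w) (isClosed_eq (by fun_prop) (by fun_prop)) hqa
  -- Since `q` is the identity on the first summand and zero on the second, `q = c` kills the first
  -- when `c = 0` and the second otherwise.
  by_cases hc0 : c = 0
  · left
    refine (Submodule.eq_bot_iff _).mpr fun x hx => ?_
    have h := hqw ⟨WithLp.toLp 2 (x, 0), hx, π₂.domain.zero_mem⟩
    rw [hc0, zero_smul] at h
    exact congrArg (fun z => (z : WithLp 2 (K₁ × K₂)).fst) (congrArg Subtype.val h)
  · right
    refine (Submodule.eq_bot_iff _).mpr fun x hx => ?_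
    have h := hqw ⟨WithLp.toLp 2 (0, x), π₁.domain.zero_mem, hx⟩
    have h' : (0 : K₂) = c • x :=
      congrArg (fun z => (z : WithLp 2 (K₁ × K₂)).snd) (congrArg Subtype.val h)
    exact (smul_eq_zero.mp h'.symm).resolve_left hc0

end PosCharacter
end Graded

end

theorem mainTheorem7 {A : Type*} [Ring A] [StarRing A] [Algebra ℂ A] [StarModule ℂ A]
    {G : Type*} [Group G] [DecidableEq G] (𝒜 : G → Submodule ℂ A) [StarGrading 𝒜]
    [IsMulCommutative (StarGrading.base 𝒜)] (h𝒜 : CompatibleCharacters 𝒜)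
    (χ : PosCharacter 𝒜) :
    χ.ind.Irreducible ↔ χ.stabilizer = ⊥ :=
  ⟨PosCharacter.stabilizer_eq_bot_of_irreducible, PosCharacter.irreducible_of_stabilizer_eq_bot⟩
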